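/- Let $(\Omega,\mathcal F,\mathbb P)$ be a probability space and let $\{X_n\}_{n=1}^\infty$ be i.i.d. real random variables on it which are almost surely nonnegative and (essentially) bounded. Let $\mathcal H$ be a complex Hilbert space with orthonormal basis $\{e_n\}_{n=1}^\infty$, and let $T=T(\omega)$ be the random weighted shift on $\mathcal H$, i.e. for almost every $\omega$ the bounded operator with $T(\omega)e_n=X_n(\omega)e_{n+1}$ for all $n\ge 1$; $T^*$ is its adjoint. Write $\operatorname{ess\,ran}X_1=\{t\in\mathbb R:\ \mathbb P(|X_1-t|<\varepsilon)>0 \text{ for all }\varepsilon>0\}$ and $R=\max\operatorname{ess\,ran}X_1$. Assume that $\operatorname{ess\,ran}X_1$ contains more than one point and that $\mathbb P(X_1=0)=0$. The expectation $\mathbb E(\ln X_1)\in[-\infty,\infty)$ is understood as $\mathbb E((\ln X_1)^+)-\mathbb E((\ln X_1)^-)$. Then: 1. $T^*$ is almost surely supercyclic. 2. $\mathbb P(T^*\text{ is hypercyclic})=1$ if $\mathbb E(\ln X_1)\ge 0$, and $=0$ if $\mathbb E(\ln X_1)<0$. 3. $\mathbb P(T^*\text{ is Li–Yorke chaotic})=1$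 if $R>1$, and $=0$ if $R\le 1$. 4. $\mathbb P(T^*\text{ is topologically mixing})=1$ if $\mathbb E(\ln X_1)>0$, and $=0$ if $\mathbb E(\ln X_1)\le 0$. 5. $\mathbb P(T^*\text{ is chaotic})=\mathbb P(T^*\text{ is frequently hypercyclic})=1$ if $\mathbb E(\ln X_1)>0$, and both are $=0$ if $\mathbb E(\ln X_1)\le 0$. Here a bounded operator $A$ on $\mathcal H$ is called - *supercyclic* if $\{\lambda A^nx:\lambda\in\mathbb C,\ n\ge 0\}$ is dense for some $x\in\mathcal H$, and *hypercyclic* if $\{A^nx:n\ge 0\}$ is dense for some $x\in\mathcal H$; - *Li–Yorke chaotic* if there is an uncountable $G\subset\mathcal H$ such that $\limsup_{n\to\infty}\|A^n(x-y)\|>0$ and $\liminf_{n\to\infty}\|A^n(x-y)\|=0$ for all distinct $x,y\in G$; - *topologically mixing* if for all nonempty open $G_1,G_2\subset\mathcal H$ there is $n\ge 1$ with $A^m(G_1)\cap G_2\neq\emptyset$ for every $m\ge n$; - *chaotic* if (a) for all nonempty open $G_1,G_2$ there is $n\ge 1$ with $A^n(G_1)\cap G_2\ne\emptyset$, (b)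 the set of $x$ with $A^kx=x$ for some $k\ge 1$ is dense, and (c) there is $\delta>0$ such that for every $x\in\mathcal H$ and every neighborhood $G$ of $x$ there are $y\in G$ and $n\ge 0$ with $\|A^nx-A^ny\|\ge\delta$; - *frequently hypercyclic* if there is $x\in\mathcal H$ such that for every nonempty open $G\subset\mathcal H$ the set $\Lambda=\{k\ge 1:A^kx\in G\}$ has positive lower density, i.e. $\liminf_{n\to\infty}\frac1n\operatorname{card}(\Lambda\cap[1,n])>0$. -/

import Mathlib

open MeasureTheory ProbabilityTheory Filter Topology Set
open scoped ENNReal lp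

noncomputable section

namespace RandomShift

/-! ### Weighted shifts -/

section Shift

variable {H : Type*} [NormedAddCommGroup H] [InnerProductSpace ℂ H] [CompleteSpace H]

open scoped Classical in
/-- The unilateral weighted shift `e n ↦ w n • e (n + 1)` with respect to the orthonormal basis
`e` of `H`, where `w` is a bounded sequence of real weights (see `weightedShift_apply_basis`).
For unbounded `w`, when no bounded operator acts in this way, the value is `0`.

The coordinate sequence of a vector is multiplied by the weights, and the resulting sequence `x`
is then sent to `∑ x n • e (n + 1)`. -/
def weightedShift (e : HilbertBasis ℕ ℂ H) (w : ℕ → ℝ) : H →L[ℂ] H :=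
  if h : ∃ C : ℝ, ∀ n, |w n| ≤ C then
    ((e.orthonormal.comp (fun n : ℕ => n + 1)
        (add_left_injective 1)).orthogonalFamily.linearIsometry.toContinuousLinearMap) ∘L
      (lp.mapCLM 2 (fun n : ℕ => (w n : ℂ) • ContinuousLinearMap.id ℂ ℂ) (K := h.choose)
        ((abs_nonneg (w 0)).trans (h.choose_spec 0))
        (fun n => by simpa [norm_smul] using h.choose_spec n)) ∘L
      (e.repr.toContinuousLinearEquiv : H →L[ℂ] ℓ²(ℕ, ℂ))
  else 0

/-- The defining property of the weighted shift with bounded weights. -/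
theorem weightedShift_apply_basis (e : HilbertBasis ℕ ℂ H) {w : ℕ → ℝ}
    (hw : ∃ C : ℝ, ∀ n, |w n| ≤ C) (n : ℕ) :
    weightedShift e w (e n) = (w n : ℂ) • e (n + 1) := by
  classical
  rw [weightedShift, dif_pos hw]
  have key : ∀ (K : ℝ) (hK : 0 ≤ K)
      (hT : ∀ i : ℕ, ‖(w i : ℂ) • ContinuousLinearMap.id ℂ ℂ‖ ≤ K),
      lp.mapCLM 2 (fun i : ℕ => (w i : ℂ) • ContinuousLinearMap.id ℂ ℂ) hK hT
        (lp.single 2 n (1 : ℂ)) = lp.single 2 n (w n : ℂ) := by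
    intro K hK hT
    ext i
    by_cases hi : i = n
    · subst hi
      simp
    · simp [hi]
  simp only [ContinuousLinearMap.comp_apply, LinearIsometry.coe_toContinuousLinearMap]
  have hrepr : (e.repr.toContinuousLinearEquiv : H →L[ℂ] ℓ²(ℕ, ℂ)) (e n)
      = lp.single 2 n (1 : ℂ) := e.repr_self n
  rw [hrepr, key, OrthogonalFamily.linearIsometry_apply_single]
  simp

/-- The random weighted shift `T ω`, with weights `X 0 ω, X 1 ω, …`. -/
def randomShift {Ω : Type*} (e : HilbertBasis ℕ ℂ H) (X : ℕ → Ω → ℝ) (ω : Ω) : H →L[ℂ] H :=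
  weightedShift e (fun n => X n ω)

end Shift

/-! ### Random variables -/

section Probability

variable {Ω : Type*} [MeasurableSpace Ω]

/-- The essential range of a real random variable. -/
def essRange (Y : Ω → ℝ) (μ : Measure Ω) : Set ℝ :=
  {t | ∀ ε : ℝ, 0 < ε → 0 < μ {ω | |Y ω - t| < ε}}

/-- `max essRange Y`: for a bounded random variable on a probability space the supremum is
attained. -/
def essMax (Y : Ω → ℝ) (μ : Measure Ω) : ℝ := sSup (essRange Y μ)

/-- The expectation `E(Y⁺) - E(Y⁻)` with values in `[-∞, ∞]`; it is meaningful as soon as one of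
the two terms is finite. -/
def eExpectation (Y : Ω → ℝ) (μ : Measure Ω) : EReal :=
  ((∫⁻ ω, ENNReal.ofReal (Y ω) ∂μ : ℝ≥0∞) : EReal)
    - ((∫⁻ ω, ENNReal.ofReal (-Y ω) ∂μ : ℝ≥0∞) : EReal)

theorem isGreatest_essMax {Y : Ω → ℝ} {μ : Measure Ω} (hne : (essRange Y μ).Nonempty)
    (hbdd : ∃ C : ℝ, ∀ᵐ ω ∂μ, Y ω ≤ C) : IsGreatest (essRange Y μ) (essMax Y μ) := by
  have hB : BddAbove (essRange Y μ) := by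
    obtain ⟨C, hC⟩ := hbdd
    refine ⟨C, fun t ht => ?_⟩
    by_contra! hlt
    refine (ht (t - C) (by linarith)).ne' (measure_mono_null (fun ω hω => ?_) hC)
    have hω' : |Y ω - t| < t - C := hω
    have := (abs_lt.mp hω').1
    simp only [mem_compl_iff, mem_ofPred_eq, not_le]
    linarith
  refine ⟨fun ε hε => ?_, fun t ht => le_csSup hB ht⟩
  obtain ⟨t, ht, hlt⟩ := exists_lt_of_lt_csSup hne
    (show essMax Y μ - ε / 2 < sSup (essRange Y μ) by unfold essMax; linarith)
  have hle : t ≤ essMax Y μ := le_csSup hB ht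
  refine (ht (ε / 2) (by linarith)).trans_le (measure_mono fun ω hω => ?_)
  have hω' : |Y ω - t| < ε / 2 := hω
  have h := abs_lt.mp hω'
  show |Y ω - essMax Y μ| < ε
  exact abs_lt.mpr ⟨by linarith [h.1], by linarith [h.2]⟩

theorem eExpectation_eq_integral {Y : Ω → ℝ} {μ : Measure Ω} (hY : Integrable Y μ) :
    eExpectation Y μ = ((∫ ω, Y ω ∂μ : ℝ) : EReal) := by
  have h1 := hY.lintegral_lt_top
  have h2 : ∫⁻ ω, ENNReal.ofReal (-Y ω) ∂μ < ∞ := hY.neg.lintegral_lt_top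
  rw [integral_eq_lintegral_pos_part_sub_lintegral_neg_part hY, EReal.coe_sub,
    EReal.coe_ennreal_toReal h1.ne, EReal.coe_ennreal_toReal h2.ne, eExpectation]

end Probability

/-! ### Linear dynamics -/

section Dynamics

variable {H : Type*} [NormedAddCommGroup H] [InnerProductSpace ℂ H]

/-- Some projective orbit `{c • A ^ n x : c ∈ ℂ, n ≥ 0}` is dense. -/
def IsSupercyclic (A : H →L[ℂ] H) : Prop :=
  ∃ x : H, Dense {y : H | ∃ (c : ℂ) (n : ℕ), y = c • (A ^ n) x}

/-- Some orbit `{A ^ n x : n ≥ 0}` is dense. -/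
def IsHypercyclic (A : H →L[ℂ] H) : Prop :=
  ∃ x : H, Dense {y : H | ∃ n : ℕ, y = (A ^ n) x}

/-- `{x, y}` is a Li–Yorke chaotic pair for `A`. The limits are taken in `[0, ∞]`, so that the
upper limit is `∞` if the sequence is unbounded. -/
def IsLiYorkePair (A : H →L[ℂ] H) (x y : H) : Prop :=
  0 < limsup (fun n : ℕ => ‖(A ^ n) (x - y)‖ₑ) atTop ∧
    liminf (fun n : ℕ => ‖(A ^ n) (x - y)‖ₑ) atTop = 0

def IsLiYorkeChaotic (A : H →L[ℂ] H) : Prop :=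
  ∃ G : Set H, ¬ G.Countable ∧ ∀ x ∈ G, ∀ y ∈ G, x ≠ y → IsLiYorkePair A x y

/-- Sensitive dependence on initial conditions. -/
def IsSensitive (A : H →L[ℂ] H) : Prop :=
  ∃ δ : ℝ, 0 < δ ∧ ∀ x : H, ∀ G ∈ 𝓝 x, ∃ y ∈ G, ∃ n : ℕ, δ ≤ ‖(A ^ n) x - (A ^ n) y‖

def IsTopologicallyMixing (A : H →L[ℂ] H) : Prop :=
  ∀ G₁ G₂ : Set H, IsOpen G₁ → G₁.Nonempty → IsOpen G₂ → G₂.Nonempty →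
    ∃ n : ℕ, 1 ≤ n ∧ ∀ m : ℕ, n ≤ m → ((fun x => (A ^ m) x) '' G₁ ∩ G₂).Nonempty

def IsTopologicallyTransitive (A : H →L[ℂ] H) : Prop :=
  ∀ G₁ G₂ : Set H, IsOpen G₁ → G₁.Nonempty → IsOpen G₂ → G₂.Nonempty →
    ∃ n : ℕ, 1 ≤ n ∧ ((fun x => (A ^ n) x) '' G₁ ∩ G₂).Nonempty

/-- Chaotic in the sense of Devaney. -/
def IsChaotic (A : H →L[ℂ] H) : Prop :=
  IsTopologicallyTransitive A ∧
    Dense {x : H | ∃ k : ℕ, 1 ≤ k ∧ (A ^ k) x = x} ∧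
    IsSensitive A

/-- The lower density of a set of positive integers. -/
def lowerDensity (S : Set ℕ) : ℝ :=
  liminf (fun n : ℕ => ((S ∩ Set.Icc 1 n).ncard : ℝ) / n) atTop

def IsFrequentlyHypercyclic (A : H →L[ℂ] H) : Prop :=
  ∃ x : H, ∀ G : Set H, IsOpen G → G.Nonempty → 0 < lowerDensity {k : ℕ | (A ^ k) x ∈ G}

end Dynamics

end RandomShift

end

open RandomShift

/-! The adjoint of the random weighted shift is the backward shift `B` with weights `X n`, and its
powers are governed by the products `P n = X 0 ⋯ X (n - 1)`. The vectors of finite support have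
backward orbits decaying like `1 / P n` and are eventually annihilated by `B`. So `B` is always
supercyclic, it is hypercyclic if and only if `P` is unbounded, mixing if and only if `P n → ∞`, and
geometric growth of `P` makes it chaotic and frequently hypercyclic. Conversely, a nonzero periodic
point forces `P n → ∞`, and so does a frequently hypercyclic vector, by comparing the densities of
its visits along an ultrafilter.

Almost surely the random walk `log P n` drifts to `±∞` with the sign of `E (log X 0)`; when this
expectation is `0`, the walk is unbounded above but does not tend to `∞`. Both facts come from
stationarity: a walk of zero drift almost surely does not stay above its starting point by a fixed
margin, in either direction.

Li–Yorke chaos depends only on the norms of the powers: if `R > r > 1`, arbitrarily long runs of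
weights `≥ r` occur, so these norms are unbounded, and Baire's theorem yields a vector whose orbit
is unbounded and comes arbitrarily close to `0`; if `R ≤ 1`, then `B` is a contraction. -/

namespace RandomShift

/-! ### Dynamics of an operator with many backward orbits -/

theorem ncard_inter_Icc_div_le_one (S : Set ℕ) (n : ℕ) :
    ((S ∩ Icc 1 n).ncard : ℝ) / n ≤ 1 := by
  refine div_le_one_of_le₀ ?_ n.cast_nonneg
  have h := ncard_le_ncard (inter_subset_right : S ∩ Icc 1 n ⊆ Icc 1 n) (finite_Icc 1 n)
  rw [ncard_eq_toFinset_card' (Icc 1 n), toFinset_Icc, Nat.card_Icc, Nat.add_sub_cancel] at h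
  exact_mod_cast h

theorem lowerDensity_pos_of_le_mul {S : Set ℕ} {f : ℕ → ℕ} {C : ℕ} (hf : f.Injective)
    (hfS : ∀ t, f t ∈ S) (hf_pos : ∀ t, 1 ≤ f t) (hf_le : ∀ t, f t ≤ C * (t + 1)) :
    0 < lowerDensity S := by
  have hC : 0 < C := Nat.pos_of_ne_zero fun h => by simpa [h] using (hf_pos 0).trans (hf_le 0)
  have hcard (n : ℕ) : n / C ≤ (S ∩ Icc 1 n).ncard := by
    have hsub : f '' Iio (n / C) ⊆ S ∩ Icc 1 n := by
      rintro _ ⟨t, ht, rfl⟩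
      exact ⟨hfS t, hf_pos t, (hf_le t).trans ((Nat.mul_le_mul_left C ht).trans
        (Nat.mul_div_le n C))⟩
    have h := ncard_le_ncard hsub ((finite_Icc 1 n).subset inter_subset_right)
    rwa [ncard_image_of_injective _ hf, ncard_eq_toFinset_card' (Iio _), toFinset_Iio,
      Nat.card_Iio] at h
  have hC' : (0 : ℝ) < C := by exact_mod_cast hC
  refine (by positivity : (0 : ℝ) < 1 / (2 * C)).trans_le (le_liminf_of_le
    (isBoundedUnder_of ⟨1, ncard_inter_Icc_div_le_one S⟩).isCoboundedUnder_ge ?_)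
  filter_upwards [eventually_ge_atTop (2 * C)] with n hn
  have hn' : (2 * C : ℝ) ≤ n := by exact_mod_cast hn
  have hdiv : (n : ℝ) / C - 1 ≤ (S ∩ Icc 1 n).ncard :=
    (Nat.sub_one_lt_floor ((n : ℝ) / C)).le.trans (by
      rw [Nat.floor_div_natCast, Nat.floor_natCast]; exact_mod_cast hcard n)
  rw [le_div_iff₀ (by linarith)]
  have hhalf : 1 / (2 * C) * (n : ℝ) = n / C - n / (2 * C) := by field_simp; ring
  have hone : 1 ≤ (n : ℝ) / (2 * C) := by rwa [one_le_div (by positivity)]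
  linarith

/-- The times at which the frequently hypercyclic vector built below visits its targets: the
`i`-th visit carries the label `v i := padicValNat 2 (i + 1)`, every label occurs with bounded gaps,
and visits with labels `k` and `l` are at least `k + l + 2` apart. -/
def rulerTime (i : ℕ) : ℕ :=
  ∑ j ∈ Finset.range i, 2 * (padicValNat 2 (j + 1) + 1) + (padicValNat 2 (i + 1) + 1)

theorem rulerTime_add_le (i k : ℕ) :
    rulerTime i + padicValNat 2 (i + 1) + 1 + k + 1 + padicValNat 2 (i + k + 2) ≤
      rulerTime (i + k + 1) := by
  have hmono : ∑ j ∈ Finset.range (i + 1), 2 * (padicValNat 2 (j + 1) + 1) + k ≤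
      ∑ j ∈ Finset.range (i + k + 1), 2 * (padicValNat 2 (j + 1) + 1) := by
    rw [show i + k + 1 = i + 1 + k by ring, Finset.sum_range_add _ (i + 1) k]
    refine Nat.add_le_add_left ?_ _
    calc k = ∑ _j ∈ Finset.range k, 1 := by simp
      _ ≤ _ := Finset.sum_le_sum fun j _ => by omega
  rw [Finset.sum_range_succ] at hmono
  simp only [rulerTime, add_assoc, Nat.reduceAdd] at hmono ⊢
  omega

theorem strictMono_rulerTime : StrictMono rulerTime :=
  strictMono_nat_of_lt_succ fun i => by
    have := rulerTime_add_le i 0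
    simp only [add_zero] at this
    omega

theorem lt_rulerTime (i : ℕ) : i < rulerTime i := by
  have h0 : 0 < rulerTime 0 := by simp [rulerTime]
  have h := strictMono_rulerTime.add_le_nat i 0
  rw [add_zero] at h
  omega

theorem padicValNat_factorial_le {p : ℕ} [Fact p.Prime] (n : ℕ) :
    padicValNat p n.factorial ≤ n := by
  have hp := (Fact.out : p.Prime).two_le
  have h := sub_one_mul_padicValNat_factorial (p := p) n
  calc padicValNat p n.factorial ≤ (p - 1) * padicValNat p n.factorial :=
        Nat.le_mul_of_pos_left _ (by omega)
    _ ≤ n := h.le.trans (Nat.sub_le _ _)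

theorem rulerTime_le (i : ℕ) : rulerTime i ≤ 4 * (i + 1) := by
  have hsum (n : ℕ) : ∑ j ∈ Finset.range n, padicValNat 2 (j + 1) = padicValNat 2 n.factorial := by
    induction n with
    | zero => simp
    | succ n ih =>
      rw [Finset.sum_range_succ, ih, Nat.factorial_succ,
        padicValNat.mul n.succ_ne_zero n.factorial_ne_zero, add_comm]
  have h := padicValNat_factorial_le (p := 2) (i + 1)
  rw [← hsum, Finset.sum_range_succ] at h
  simp only [rulerTime, mul_add, Finset.sum_add_distrib, ← Finset.mul_sum, Finset.sum_const,
    Finset.card_range, smul_eq_mul]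
  omega

theorem lowerDensity_rulerTime_pos {S : Set ℕ} {k : ℕ}
    (hS : ∀ i, padicValNat 2 (i + 1) = k → rulerTime i ∈ S) : 0 < lowerDensity S := by
  have hidx (t : ℕ) : 2 ^ k * (2 * t + 1) - 1 + 1 = 2 ^ k * (2 * t + 1) :=
    Nat.sub_add_cancel (Nat.pos_of_ne_zero (by positivity))
  refine lowerDensity_pos_of_le_mul (f := fun t => rulerTime (2 ^ k * (2 * t + 1) - 1))
    (C := 8 * 2 ^ k) (strictMono_rulerTime.injective.comp fun s t hst => ?_) (fun t => hS _ ?_)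
    (fun t => Nat.one_le_of_lt (lt_rulerTime _)) fun t => ?_
  · have h := congrArg (· + 1) hst
    simp only [hidx] at h
    have := Nat.eq_of_mul_eq_mul_left (by positivity) h
    omega
  · rw [hidx, padicValNat.mul (by positivity) (by omega), padicValNat.prime_pow,
      padicValNat.eq_zero_of_not_dvd (by omega), add_zero]
  · refine (rulerTime_le _).trans ?_
    rw [hidx]
    nlinarith [Nat.pos_of_ne_zero (pow_ne_zero k two_ne_zero)]

section Transitivity

theorem exists_dense_orbit {X ι : Type*} [TopologicalSpace X] [BaireSpace X] [Nonempty X]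
    [SecondCountableTopology X] {f : ι → X → X} (hf : ∀ i, Continuous (f i))
    (h : ∀ U V : Set X, IsOpen U → U.Nonempty → IsOpen V → V.Nonempty →
      ∃ i, ∃ x ∈ U, f i x ∈ V) :
    ∃ x, Dense {y | ∃ i, y = f i x} := by
  have hbasis := TopologicalSpace.isBasis_countableBasis X
  have : Countable (TopologicalSpace.countableBasis X) :=
    (TopologicalSpace.countable_countableBasis X).to_subtype
  have hdense : Dense (⋂ V : TopologicalSpace.countableBasis X, ⋃ i, f i ⁻¹' V) := by
    refine dense_iInter_of_isOpen (fun V => isOpen_iUnion fun i =>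
      (hbasis.isOpen V.2).preimage (hf i)) fun V => dense_iff_inter_open.2 fun U hU hUne => ?_
    obtain ⟨i, x, hx, hxV⟩ := h U V hU hUne (hbasis.isOpen V.2)
      (TopologicalSpace.nonempty_of_mem_countableBasis V.2)
    exact ⟨x, hx, mem_iUnion.2 ⟨i, hxV⟩⟩
  obtain ⟨x, hx⟩ := hdense.nonempty
  refine ⟨x, hbasis.dense_iff.2 fun V hV _ => ?_⟩
  obtain ⟨i, hi⟩ := mem_iUnion.1 (mem_iInter.1 hx ⟨V, hV⟩)
  exact ⟨f i x, hi, i, rfl⟩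

variable {H : Type*} [NormedAddCommGroup H] [InnerProductSpace ℂ H] {A : H →L[ℂ] H}

theorem IsTopologicallyMixing.isTopologicallyTransitive (h : IsTopologicallyMixing A) :
    IsTopologicallyTransitive A := by
  intro U V hU hUne hV hVne
  obtain ⟨n, hn, hn'⟩ := h U V hU hUne hV hVne
  exact ⟨n, hn, hn' n le_rfl⟩

theorem IsTopologicallyTransitive.isSensitive [Nontrivial H] (h : IsTopologicallyTransitive A) :
    IsSensitive A := by
  refine ⟨1, one_pos, fun x G hG => ?_⟩
  obtain ⟨U, hUG, hU, hxU⟩ := mem_nhds_iff.1 hG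
  obtain ⟨y, hy⟩ := NormedSpace.exists_lt_norm ℂ H 1
  obtain ⟨n, -, _, ⟨z, hz, rfl⟩, hzn⟩ := h ((fun z => x + z) ⁻¹' U) {y | 1 < ‖y‖}
    (hU.preimage (by fun_prop)) ⟨0, by simpa using hxU⟩
    (isOpen_lt continuous_const continuous_norm) ⟨y, hy⟩
  refine ⟨x + z, hUG hz, n, ?_⟩
  rw [map_add, norm_sub_rev, add_sub_cancel_left]
  exact le_of_lt hzn

end Transitivity

/-- A family of backward orbits `S a 0, S a 1, …` of the operator `A` whose starting points
`S a 0` are dense and are eventually annihilated by `A`. Such a family is the input of the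
classical criteria for chaotic behaviour; which of them applies is decided by the decay of
`S a n` as `n → ∞`. -/
structure IsBackwardOrbitFamily {𝕜 E α : Type*} [NontriviallyNormedField 𝕜]
    [NormedAddCommGroup E] [NormedSpace 𝕜 E] (A : E →L[𝕜] E) (S : α → ℕ → E) : Prop where
  denseRange : DenseRange fun a => S a 0
  apply_succ : ∀ a n, A (S a (n + 1)) = S a n
  eventually_pow_eq_zero : ∀ a, ∀ᶠ n in atTop, (A ^ n) (S a 0) = 0

section Orbit

variable {𝕜 E : Type*} [NontriviallyNormedField 𝕜] [NormedAddCommGroup E] [NormedSpace 𝕜 E]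
  {A : E →L[𝕜] E}

theorem pow_apply_add_of_apply_succ {s : ℕ → E} (hs : ∀ n, A (s (n + 1)) = s n) (m n : ℕ) :
    (A ^ m) (s (m + n)) = s n := by
  induction m generalizing n with
  | zero => simp
  | succ m ih => rw [pow_succ', mul_apply_eq_comp, add_assoc, ih, add_comm 1, hs]

theorem exists_norm_pow_rulerTime_sub_le [CompleteSpace E] {u : ℕ → ℕ → E} {σ : ℝ} (hσ0 : 0 ≤ σ)
    (hσ1 : σ < 1) (hu : ∀ k n, A (u k (n + 1)) = u k n)
    (hzero : ∀ k r, k < r → (A ^ r) (u k 0) = 0) (hnorm : ∀ k r, k < r → ‖u k r‖ ≤ σ ^ r) :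
    ∃ x, ∀ i, ‖(A ^ rulerTime i) x - u (padicValNat 2 (i + 1)) 0‖ ≤
      σ ^ padicValNat 2 (i + 1) * (1 - σ)⁻¹ := by
  set v : ℕ → ℕ := fun i => padicValNat 2 (i + 1)
  have hgap (i k : ℕ) : rulerTime i + v i + k + v (i + k + 1) < rulerTime (i + k + 1) :=
    (rulerTime_add_le i k).trans_lt' (by simp only [v]; ring_nf; omega)
  have hsum : Summable fun i => u (v i) (rulerTime i) := by
    refine Summable.of_norm_bounded (summable_geometric_of_lt_one hσ0 hσ1) fun i =>
      (hnorm _ _ ?_).trans (pow_le_pow_of_le_one hσ0 hσ1.le (lt_rulerTime i).le)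
    simp only [v, rulerTime]
    omega
  refine ⟨∑' j, u (v j) (rulerTime j), fun i => ?_⟩
  have hpast : ∀ j ∈ Finset.range i, (A ^ rulerTime i) (u (v j) (rulerTime j)) = 0 := by
    intro j hj
    obtain ⟨k, rfl⟩ := Nat.exists_eq_add_of_lt (Finset.mem_range.1 hj)
    have h := hgap j k
    have hsplit : rulerTime (j + k + 1) = rulerTime (j + k + 1) - rulerTime j + rulerTime j := by
      omega
    have hvisit := pow_apply_add_of_apply_succ (hu (v j)) (rulerTime j) 0
    rw [add_zero] at hvisit
    rw [hsplit, pow_add, mul_apply_eq_comp, hvisit]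
    exact hzero _ _ (by omega)
  have hfuture (k : ℕ) : ‖(A ^ rulerTime i) (u (v (k + (i + 1))) (rulerTime (k + (i + 1))))‖ ≤
      σ ^ v i * σ ^ k := by
    have h := hgap i k
    rw [show k + (i + 1) = i + k + 1 by ring]
    obtain ⟨r, hr⟩ := Nat.exists_eq_add_of_lt h
    rw [hr, show rulerTime i + v i + k + v (i + k + 1) + r + 1 =
      rulerTime i + (v i + k + v (i + k + 1) + r + 1) by ring, pow_apply_add_of_apply_succ (hu _),
      ← pow_add]
    exact (hnorm _ _ (by omega)).trans (pow_le_pow_of_le_one hσ0 hσ1.le (by omega))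
  have hpresent : (A ^ rulerTime i) (u (v i) (rulerTime i)) = u (v i) 0 :=
    pow_apply_add_of_apply_succ (hu (v i)) (rulerTime i) 0
  have hsum' := hsum.mapL (A ^ rulerTime i)
  rw [(A ^ rulerTime i).map_tsum hsum, ← hsum'.sum_add_tsum_nat_add (i + 1),
    Finset.sum_range_succ, Finset.sum_eq_zero hpast, zero_add, hpresent, add_sub_cancel_left]
  exact tsum_of_norm_bounded ((hasSum_geometric_of_lt_one hσ0 hσ1).mul_left _) hfuture

end Orbit

namespace IsBackwardOrbitFamily

section NormedSpace

variable {𝕜 E α : Type*} [NontriviallyNormedField 𝕜] [NormedAddCommGroup E] [NormedSpace 𝕜 E]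
  {A : E →L[𝕜] E} {S : α → ℕ → E} (h : IsBackwardOrbitFamily A S)

include h

theorem pow_apply_add (a : α) (m n : ℕ) : (A ^ m) (S a (m + n)) = S a n :=
  pow_apply_add_of_apply_succ (h.apply_succ a) m n

theorem pow_apply (a : α) (n : ℕ) : (A ^ n) (S a n) = S a 0 :=
  h.pow_apply_add a n 0

theorem eventually_exists_mem {m : ℕ → ℕ} (hm : Tendsto m atTop atTop)
    (hS : ∀ a, Tendsto (fun i => S a (m i)) atTop (𝓝 0)) {U V : Set E}
    (hU : IsOpen U) (hUne : U.Nonempty) (hV : IsOpen V) (hVne : V.Nonempty) :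
    ∀ᶠ i in atTop, ∃ x ∈ U, (A ^ m i) x ∈ V := by
  obtain ⟨a, ha⟩ := h.denseRange.exists_mem_open hU hUne
  obtain ⟨b, hb⟩ := h.denseRange.exists_mem_open hV hVne
  have hlim := (hS b).const_add (S a 0)
  rw [add_zero] at hlim
  filter_upwards [hlim.eventually (hU.mem_nhds ha), hm.eventually (h.eventually_pow_eq_zero a)]
    with i hmem hzero
  refine ⟨_, hmem, ?_⟩
  rwa [map_add, hzero, zero_add, h.pow_apply]

theorem dense_setOf_pow_apply_eq_self [CompleteSpace E] (hS : ∀ a, Summable fun n => ‖S a n‖) :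
    Dense {x | ∃ k : ℕ, 1 ≤ k ∧ (A ^ k) x = x} := by
  refine dense_closure.1 (h.denseRange.mono (range_subset_iff.2 fun a => ?_))
  set x : ℕ → E := fun N => ∑' j, S a (j * N)
  have hinj {N : ℕ} (hN : 1 ≤ N) : Function.Injective fun j => j * N :=
    mul_left_injective₀ (Nat.one_le_iff_ne_zero.1 hN)
  have hsum {N : ℕ} (hN : 1 ≤ N) : Summable fun j => S a (j * N) :=
    ((hS a).comp_injective (hinj hN)).of_norm
  have hdist : ∀ᶠ N in atTop, ‖x N - S a 0‖ ≤ ∑' n, ‖S a (n + N)‖ := by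
    filter_upwards [eventually_ge_atTop 1] with N hN
    have htail := (summable_nat_add_iff N).2 (hS a)
    have hsub : (fun j => ‖S a ((j + 1) * N)‖) = (fun n => ‖S a (n + N)‖) ∘ (· * N) := by
      funext j
      simp only [Function.comp_apply, add_mul, one_mul]
    simp only [x]
    rw [(hsum hN).tsum_eq_zero_add, zero_mul, add_sub_cancel_left]
    refine (norm_tsum_le_tsum_norm ?_).trans ?_
    · rw [hsub]
      exact htail.comp_injective (hinj hN)
    · rw [hsub]
      exact tsum_comp_le_tsum_of_inj htail (fun _ => norm_nonneg _) (hinj hN)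
  have hlim : Tendsto x atTop (𝓝 (S a 0)) :=
    tendsto_iff_norm_sub_tendsto_zero.2 (squeeze_zero' (Eventually.of_forall fun _ =>
      norm_nonneg _) hdist (tendsto_sum_nat_add fun n => ‖S a n‖))
  refine mem_closure_of_tendsto hlim ?_
  filter_upwards [eventually_ge_atTop 1, h.eventually_pow_eq_zero a] with N hN hzero
  refine ⟨N, hN, ?_⟩
  simp only [x]
  rw [(A ^ N).map_tsum (hsum hN), ((hsum hN).mapL (A ^ N)).tsum_eq_zero_add, zero_mul, hzero,
    zero_add]
  exact tsum_congr fun j => by rw [add_mul, one_mul, add_comm, h.pow_apply_add]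

theorem exists_forall_norm_le_pow {ρ σ : ℝ} (hρ0 : 0 ≤ ρ) (hρσ : ρ < σ)
    (hS : ∀ a, S a =O[atTop] fun n => ρ ^ n) (a : α) :
    ∃ L, ∀ r ≥ L, ‖S a r‖ ≤ σ ^ r ∧ (A ^ r) (S a 0) = 0 := by
  have hdecay := ((hS a).trans_isLittleO (isLittleO_pow_pow_of_lt_left hρ0 hρσ)).bound one_pos
  refine eventually_atTop.1 ?_
  filter_upwards [hdecay, h.eventually_pow_eq_zero a] with r hr hzero
  rw [one_mul, norm_pow, Real.norm_of_nonneg (hρ0.trans hρσ.le)] at hr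
  exact ⟨hr, hzero⟩

end NormedSpace

variable {H α : Type*} [NormedAddCommGroup H] [InnerProductSpace ℂ H] {A : H →L[ℂ] H}
  {S : α → ℕ → H}

theorem isTopologicallyMixing (h : IsBackwardOrbitFamily A S)
    (hS : ∀ a, Tendsto (S a) atTop (𝓝 0)) : IsTopologicallyMixing A := by
  intro U V hU hUne hV hVne
  obtain ⟨N, hN⟩ := eventually_atTop.1 (h.eventually_exists_mem tendsto_id hS hU hUne hV hVne)
  refine ⟨N + 1, by omega, fun m hm => ?_⟩
  obtain ⟨x, hx, hxV⟩ := hN m (by omega)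
  exact ⟨_, ⟨x, hx, rfl⟩, hxV⟩

variable [CompleteSpace H]

theorem isChaotic [Nontrivial H] (h : IsBackwardOrbitFamily A S)
    (hS : ∀ a, Summable fun n => ‖S a n‖) : IsChaotic A :=
  have htrans := (h.isTopologicallyMixing fun a =>
    tendsto_zero_iff_norm_tendsto_zero.2 (hS a).tendsto_atTop_zero).isTopologicallyTransitive
  ⟨htrans, h.dense_setOf_pow_apply_eq_self hS, htrans.isSensitive⟩

variable [SecondCountableTopology H]

theorem isHypercyclic (h : IsBackwardOrbitFamily A S) {m : ℕ → ℕ} (hm : Tendsto m atTop atTop)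
    (hS : ∀ a, Tendsto (fun i => S a (m i)) atTop (𝓝 0)) : IsHypercyclic A :=
  exists_dense_orbit (fun n => (A ^ n).continuous) fun _ _ hU hUne hV hVne =>
    let ⟨i, hi⟩ := (h.eventually_exists_mem hm hS hU hUne hV hVne).exists
    ⟨m i, hi⟩

theorem isSupercyclic (h : IsBackwardOrbitFamily A S) : IsSupercyclic A := by
  obtain ⟨x, hx⟩ := exists_dense_orbit (f := fun (p : ℂ × ℕ) (x : H) => p.1 • (A ^ p.2) x)
    (fun p => by fun_prop) (by
      intro U V hU hUne hV hVne
      obtain ⟨a, ha⟩ := h.denseRange.exists_mem_open hU hUne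
      obtain ⟨b, hb⟩ := h.denseRange.exists_mem_open hV hVne
      obtain ⟨N, hN⟩ := (h.eventually_pow_eq_zero a).exists
      have hlim : Tendsto (fun t : ℝ => S a 0 + (t : ℂ) • S b N) (𝓝[>] 0) (𝓝 (S a 0)) := by
        have hcont : Continuous fun t : ℝ => S a 0 + (t : ℂ) • S b N := by fun_prop
        simpa using (hcont.tendsto 0).mono_left nhdsWithin_le_nhds
      obtain ⟨t, htU, ht⟩ :=
        ((hlim.eventually (hU.mem_nhds ha)).and self_mem_nhdsWithin).exists
      have ht' : (t : ℂ) ≠ 0 := Complex.ofReal_ne_zero.2 (ne_of_gt ht)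
      refine ⟨((t : ℂ)⁻¹, N), _, htU, ?_⟩
      rwa [map_add, hN, zero_add, map_smul, h.pow_apply, inv_smul_smul₀ ht'])
  refine ⟨x, hx.mono ?_⟩
  rintro y ⟨⟨c, n⟩, rfl⟩
  exact ⟨c, n, rfl⟩

theorem isFrequentlyHypercyclic (h : IsBackwardOrbitFamily A S) {ρ : ℝ} (hρ0 : 0 ≤ ρ)
    (hρ1 : ρ < 1) (hS : ∀ a, S a =O[atTop] fun n => ρ ^ n) : IsFrequentlyHypercyclic A := by
  obtain ⟨σ, hρσ, hσ1⟩ := exists_between hρ1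
  have hσ0 : 0 < σ := hρ0.trans_lt hρσ
  choose L hL using h.exists_forall_norm_le_pow hρ0 hρσ hS
  obtain ⟨t, ht_sub, ht_countable, ht_dense⟩ := h.denseRange.exists_countable_dense_subset
  obtain ⟨target, rfl⟩ := ht_countable.exists_eq_range ht_dense.nonempty
  choose f hf using fun k => ht_sub (mem_range_self k)
  -- The label `k` aims at the target `k.unpair.1`, provided that `k` exceeds its settling time.
  let u : ℕ → ℕ → H := fun k => if L (f k.unpair.1) ≤ k then S (f k.unpair.1) else 0
  obtain ⟨x, hx⟩ := exists_norm_pow_rulerTime_sub_le (A := A) (u := u) hσ0.le hσ1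
    (fun k n => by simp only [u]; split_ifs <;> simp [h.apply_succ])
    (fun k r hr => by
      simp only [u]
      split_ifs with hk
      exacts [(hL _ r (hk.trans hr.le)).2, map_zero _])
    (fun k r hr => by
      simp only [u]
      split_ifs with hk
      exacts [(hL _ r (hk.trans hr.le)).1, by simp [hσ0.le]])
  refine ⟨x, fun G hG hGne => ?_⟩
  obtain ⟨_, ⟨k, rfl⟩, hmem⟩ := ht_dense.exists_mem_open hG hGne
  obtain ⟨ε, hε, hball⟩ := Metric.isOpen_iff.1 hG _ hmem
  have herror : Tendsto (fun n => σ ^ n * (1 - σ)⁻¹) atTop (𝓝 0) := by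
    simpa using (tendsto_pow_atTop_nhds_zero_of_lt_one hσ0.le hσ1).mul_const (1 - σ)⁻¹
  obtain ⟨n, hn⟩ := eventually_atTop.1 (herror.eventually_lt_const hε)
  set label := Nat.pair k (max (L (f k)) n)
  have hlabel : max (L (f k)) n ≤ label := Nat.right_le_pair _ _
  have hu : u label 0 = target k := by
    simp only [u, label, Nat.unpair_pair, if_pos ((le_max_left _ _).trans hlabel), hf]
  refine lowerDensity_rulerTime_pos (k := label) fun i hi => hball (mem_ball_iff_norm.2 ?_)
  have hxi := hx i
  rw [hi, hu] at hxi
  exact hxi.trans_lt (hn _ ((le_max_right _ _).trans hlabel))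

end IsBackwardOrbitFamily

/-! ### Li–Yorke chaos -/

section Residual

variable {𝕜 E F : Type*} [NontriviallyNormedField 𝕜] [NormedAddCommGroup E] [NormedSpace 𝕜 E]
  [NormedAddCommGroup F] [NormedSpace 𝕜 F] {T : ℕ → E →L[𝕜] F}

theorem eventually_residual_liminf_enorm_eq_zero (hT : Dense {x | ∃ᶠ n in atTop, T n x = 0}) :
    ∀ᶠ x in residual E, liminf (fun n => ‖T n x‖ₑ) atTop = 0 := by
  have hsmall (p : ℕ × ℕ) : ∀ᶠ x in residual E, ∃ n ≥ p.1, ‖T n x‖ₑ < ((p.2 : ℝ≥0∞) + 1)⁻¹ := by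
    refine residual_of_dense_open ?_ (hT.mono fun x hx => ?_)
    · simp only [ge_iff_le, ofPred_exists, ← exists_prop]
      exact isOpen_iUnion fun n => isOpen_iUnion fun _ =>
        isOpen_lt (T n).continuous.enorm continuous_const
    · obtain ⟨n, hn, hzero⟩ := frequently_atTop.1 hx p.1
      exact ⟨n, hn, by simp [hzero]⟩
  filter_upwards [eventually_countable_forall.2 hsmall] with x hx
  refine le_antisymm (le_of_forall_gt_imp_ge_of_dense fun ε hε => ?_) zero_le
  obtain ⟨k, hk⟩ := ENNReal.exists_inv_nat_lt hε.ne'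
  refine liminf_le_of_frequently_le (frequently_atTop.2 fun N => ?_)
  obtain ⟨n, hn, hlt⟩ := hx (N, k)
  exact ⟨n, hn, hlt.le.trans ((ENNReal.inv_le_inv.2 le_self_add).trans hk.le)⟩

theorem eventually_residual_not_bddAbove [CompleteSpace E]
    (hT : ¬ BddAbove (range fun n => ‖T n‖)) :
    ∀ᶠ x in residual E, ¬ BddAbove (range fun n => ‖T n x‖) := by
  let bounded : Submodule 𝕜 E :=
    { carrier := {x | BddAbove (range fun n => ‖T n x‖)}
      zero_mem' := ⟨0, by rintro _ ⟨n, rfl⟩; simp⟩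
      add_mem' := by
        rintro x y ⟨a, ha⟩ ⟨b, hb⟩
        refine ⟨a + b, ?_⟩
        rintro _ ⟨n, rfl⟩
        simp only [map_add]
        exact norm_add_le_of_le (ha ⟨n, rfl⟩) (hb ⟨n, rfl⟩)
      smul_mem' := by
        rintro c x ⟨a, ha⟩
        refine ⟨‖c‖ * a, ?_⟩
        rintro _ ⟨n, rfl⟩
        simp only [map_smul, norm_smul]
        exact mul_le_mul_of_nonneg_left (ha ⟨n, rfl⟩) (norm_nonneg c) }
  have hproper : bounded ≠ ⊤ := fun htop => hT (by
    obtain ⟨C, hC⟩ := banach_steinhaus fun x => by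
      obtain ⟨C, hC⟩ : x ∈ bounded := htop ▸ Submodule.mem_top
      exact ⟨C, fun n => hC ⟨n, rfl⟩⟩
    exact ⟨C, forall_mem_range.2 hC⟩)
  have hlarge (k : ℕ) : ∀ᶠ x in residual E, ∃ n, (k : ℝ) < ‖T n x‖ := by
    refine residual_of_dense_open ?_ ?_
    · rw [ofPred_exists]
      exact isOpen_iUnion fun n => isOpen_lt continuous_const (T n).continuous.norm
    · refine dense_iff_inter_open.2 fun U hU ⟨y, hy⟩ => ?_
      by_contra! hempty
      refine hproper (bounded.eq_top_of_nonempty_interior' ⟨y, interior_maximal ?_ hU hy⟩)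
      rintro z hz
      refine ⟨k, forall_mem_range.2 fun n => not_lt.1 fun hlt => ?_⟩
      exact (hempty ▸ ⟨hz, n, hlt⟩ : z ∈ (∅ : Set E))
  filter_upwards [eventually_countable_forall.2 hlarge] with x hx
  rintro ⟨C, hC⟩
  obtain ⟨k, hk⟩ := exists_nat_ge C
  obtain ⟨n, hn⟩ := hx k
  exact (hn.trans_le ((hC ⟨n, rfl⟩).trans hk)).false

end Residual

section Irregular

variable {H : Type*} [NormedAddCommGroup H] [InnerProductSpace ℂ H] {A : H →L[ℂ] H} {x : H}

/-- Beauzamy's irregular vectors: the orbit is unbounded and has a subsequence tending to `0`.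
The multiples of such a vector form a Li–Yorke scrambled set. -/
def IsIrregularVector (A : H →L[ℂ] H) (x : H) : Prop :=
  liminf (fun n : ℕ => ‖(A ^ n) x‖ₑ) atTop = 0 ∧ limsup (fun n : ℕ => ‖(A ^ n) x‖ₑ) atTop = ∞

theorem IsIrregularVector.isLiYorkeChaotic (h : IsIrregularVector A x) : IsLiYorkeChaotic A := by
  have hx : x ≠ 0 := by
    rintro rfl
    simpa using h.2
  refine ⟨range fun c : ℂ => c • x, fun hcountable => ?_, ?_⟩
  · have hpre := hcountable.preimage (smul_left_injective ℂ hx)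
    rw [preimage_range] at hpre
    exact not_countable_complex hpre
  · rintro _ ⟨c, rfl⟩ _ ⟨d, rfl⟩ hcd
    have hne : ‖c - d‖ₑ ≠ 0 := by
      rw [enorm_ne_zero, sub_ne_zero]
      rintro rfl
      exact hcd rfl
    have horbit : (fun n : ℕ => ‖(A ^ n) (c • x - d • x)‖ₑ) =
        fun n => ‖c - d‖ₑ * ‖(A ^ n) x‖ₑ := by
      funext n
      rw [← sub_smul, map_smul, enorm_smul]
    refine ⟨?_, ?_⟩
    · rw [horbit, ENNReal.limsup_const_mul_of_ne_top enorm_ne_top, h.2, ENNReal.mul_top hne]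
      exact ENNReal.zero_lt_top
    · rw [horbit, ENNReal.liminf_const_mul_of_ne_top enorm_ne_top, h.1, mul_zero]

theorem exists_isIrregularVector [CompleteSpace H]
    (hzero : Dense {x : H | ∃ᶠ n in atTop, (A ^ n) x = 0})
    (hnorm : ¬ BddAbove (range fun n : ℕ => ‖A ^ n‖)) : ∃ x, IsIrregularVector A x := by
  obtain ⟨x, hliminf, hunbounded⟩ := ((eventually_residual_liminf_enorm_eq_zero hzero).and
    (eventually_residual_not_bddAbove hnorm)) |> dense_of_mem_residual |>.nonempty
  refine ⟨x, hliminf, ?_⟩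
  by_contra hlimsup
  obtain ⟨c, hc, hc_top⟩ := exists_between (lt_top_iff_ne_top.2 hlimsup)
  refine hunbounded (IsBoundedUnder.bddAbove_range ⟨c.toReal, eventually_map.2 ?_⟩)
  filter_upwards [eventually_lt_of_limsup_lt hc] with n hn
  exact toReal_enorm ((A ^ n) x) ▸ ENNReal.toReal_mono hc_top.ne hn.le

theorem not_isLiYorkeChaotic_of_norm_le (hA : ∀ x, ‖A x‖ ≤ ‖x‖) : ¬ IsLiYorkeChaotic A := by
  rintro ⟨G, hG, h⟩
  obtain ⟨x, hx, y, hy, hxy⟩ : G.Nontrivial :=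
    not_subsingleton_iff.1 fun hsub => hG hsub.countable
  have hanti : Antitone fun n : ℕ => ‖(A ^ n) (x - y)‖ₑ := antitone_nat_of_succ_le fun n => by
    rw [pow_succ', mul_apply_eq_comp]
    exact enorm_le_iff_norm_le.2 (hA _)
  obtain ⟨hlimsup, hliminf⟩ := h x hx y hy hxy
  have hlim := tendsto_atTop_iInf hanti
  exact hlimsup.ne' (hlim.limsup_eq.trans (hlim.liminf_eq.symm.trans hliminf))

end Irregular

/-! ### Backward shifts -/

section WeightProd

/-- The products of the initial segments of a weight sequence; they govern the powers of the
backward shift. -/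
noncomputable def weightProd (w : ℕ → ℝ) (n : ℕ) : ℝ := ∏ i ∈ Finset.range n, w i

variable {w : ℕ → ℝ}

theorem weightProd_succ (w : ℕ → ℝ) (n : ℕ) : weightProd w (n + 1) = weightProd w n * w n :=
  Finset.prod_range_succ _ _

theorem weightProd_add (w : ℕ → ℝ) (n k : ℕ) :
    weightProd w (n + k) = weightProd w n * ∏ i ∈ Finset.range k, w (n + i) :=
  Finset.prod_range_add _ _ _

theorem weightProd_pos (hw : ∀ n, 0 < w n) (n : ℕ) : 0 < weightProd w n :=
  Finset.prod_pos fun i _ => hw i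

theorem pow_mul_weightProd_le (hw : ∀ n, 0 < w n) {ρ : ℝ} (hρ : 0 ≤ ρ) {k L : ℕ}
    (hrun : ∀ i < L, ρ ≤ w (k + i)) : ρ ^ L * weightProd w k ≤ weightProd w (k + L) := by
  have hprod : ∏ _i ∈ Finset.range L, ρ ≤ ∏ i ∈ Finset.range L, w (k + i) :=
    Finset.prod_le_prod (fun _ _ => hρ) fun i hi => hrun i (Finset.mem_range.1 hi)
  rw [Finset.prod_const, Finset.card_range] at hprod
  rw [weightProd_add, mul_comm]
  exact mul_le_mul_of_nonneg_left hprod (weightProd_pos hw k).le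

theorem exists_weightProd_add_le (hw : ∀ n, 0 < w n) (hbdd : BddAbove (range w)) :
    ∃ C : ℝ, 1 ≤ C ∧ ∀ n k, weightProd w (n + k) ≤ C ^ k * weightProd w n := by
  obtain ⟨C, hC⟩ := hbdd
  refine ⟨max C 1, le_max_right _ _, fun n k => ?_⟩
  have hprod : ∏ i ∈ Finset.range k, w (n + i) ≤ ∏ _i ∈ Finset.range k, max C 1 :=
    Finset.prod_le_prod (fun i _ => (hw _).le) fun i _ =>
      (hC (mem_range_self _)).trans (le_max_left _ _)
  rw [Finset.prod_const, Finset.card_range] at hprod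
  rw [weightProd_add, mul_comm]
  exact mul_le_mul_of_nonneg_right hprod (weightProd_pos hw n).le

theorem exists_forall_le_weightProd_add (hw : ∀ n, 0 < w n) (hbdd : BddAbove (range w))
    (hP : ¬ BddAbove (range (weightProd w))) (i : ℕ) :
    ∃ m ≥ i, ∀ k ≤ i, (i : ℝ) ≤ weightProd w (k + m) := by
  obtain ⟨C, hC1, hC⟩ := exists_weightProd_add_le hw hbdd
  obtain ⟨_, ⟨n, rfl⟩, hn⟩ := not_bddAbove_iff.1 hP (C ^ (2 * i) * (i + 1))
  have hpos : 0 < C ^ (2 * i) := by positivity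
  have hlarge : 2 * i ≤ n := by
    by_contra! hlt
    have hPn : weightProd w n ≤ C ^ n := by simpa [weightProd] using hC 0 n
    have hpow : C ^ n ≤ C ^ (2 * i) := pow_le_pow_right₀ hC1 hlt.le
    nlinarith [mul_nonneg hpos.le (Nat.cast_nonneg (α := ℝ) i)]
  refine ⟨n - i, by omega, fun k hk => ?_⟩
  have hstep : weightProd w n ≤ C ^ (2 * i) * weightProd w (k + (n - i)) :=
    calc weightProd w n = weightProd w (k + (n - i) + (i - k)) := by congr 1; omega
      _ ≤ C ^ (i - k) * weightProd w (k + (n - i)) := hC _ _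
      _ ≤ C ^ (2 * i) * weightProd w (k + (n - i)) :=
        mul_le_mul_of_nonneg_right (pow_le_pow_right₀ hC1 (by omega)) (weightProd_pos hw _).le
  linarith [lt_of_mul_lt_mul_left (hn.trans_le hstep) hpos.le]

theorem tendsto_weightProd_of_syndetic (hw : ∀ n, 0 < w n) (hbdd : BddAbove (range w)) {L : ℕ}
    (h : ∀ K : ℝ, ∀ᶠ n in atTop, ∃ k ≤ L, K ≤ weightProd w (n + k)) :
    Tendsto (weightProd w) atTop atTop := by
  obtain ⟨C, hC1, hC⟩ := exists_weightProd_add_le hw hbdd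
  refine tendsto_atTop.2 fun K => ?_
  filter_upwards [h (C ^ L * K)] with n ⟨k, hk, hK⟩
  refine le_of_mul_le_mul_left ?_ (pow_pos (one_pos.trans_le hC1) L)
  calc C ^ L * K ≤ weightProd w (n + k) := hK
    _ ≤ C ^ k * weightProd w n := hC n k
    _ ≤ C ^ L * weightProd w n :=
      mul_le_mul_of_nonneg_right (pow_le_pow_right₀ hC1 hk) (weightProd_pos hw n).le

end WeightProd

section Coordinates

variable {H : Type*} [NormedAddCommGroup H] [InnerProductSpace ℂ H] (e : HilbertBasis ℕ ℂ H)

theorem repr_basis_apply (i j : ℕ) : e.repr (e i) j = if j = i then 1 else 0 := by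
  simp [e.repr_self, Pi.single_apply]

theorem norm_repr_le (x : H) (n : ℕ) : ‖e.repr x n‖ ≤ ‖x‖ := by
  rw [← e.repr.norm_map x]
  exact lp.norm_apply_le_norm (by norm_num) _ _

theorem hasSum_sq_norm_repr (x : H) : HasSum (fun n => ‖e.repr x n‖ ^ 2) (‖x‖ ^ 2) := by
  have hsummable : Summable fun n => ‖e.repr x n‖ ^ 2 := by
    simpa using (lp.memℓp (e.repr x)).summable (by norm_num)
  have hnorm : ‖x‖ ^ 2 = ∑' n, ‖e.repr x n‖ ^ 2 := by
    rw [← e.repr.norm_map x]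
    simpa using lp.norm_rpow_eq_tsum (p := 2) (by norm_num) (e.repr x)
  exact hnorm ▸ hsummable.hasSum

theorem tendsto_norm_repr (x : H) : Tendsto (fun n => ‖e.repr x n‖) atTop (𝓝 0) := by
  simpa [Real.sqrt_sq] using (hasSum_sq_norm_repr e x).summable.tendsto_atTop_zero.sqrt

theorem isOpen_setOf_lt_norm_repr (K : ℝ) (n : ℕ) : IsOpen {x : H | K < ‖e.repr x n‖} := by
  simp only [e.repr_apply_apply]
  exact isOpen_lt continuous_const (by fun_prop)

theorem nonempty_setOf_lt_norm_repr (K : ℝ) (n : ℕ) : {x : H | K < ‖e.repr x n‖}.Nonempty := by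
  refine ⟨((|K| + 1 : ℝ) : ℂ) • e n, ?_⟩
  rw [mem_ofPred_eq, map_smul, lp.coeFn_smul, Pi.smul_apply, repr_basis_apply, if_pos rfl,
    norm_smul, norm_one, mul_one, Complex.norm_real, Real.norm_of_nonneg (by positivity)]
  exact (le_abs_self K).trans_lt (lt_add_one _)

include e in
theorem secondCountableTopology_of_hilbertBasis : SecondCountableTopology H := by
  have hspan := ((countable_range e).isSeparable.span (R := ℂ)).closure
  rw [← Submodule.topologicalClosure_coe, e.dense_span, Submodule.top_coe,
    TopologicalSpace.isSeparable_univ_iff] at hspan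
  exact UniformSpace.secondCountable_of_separable H

include e in
theorem nontrivial_of_hilbertBasis : Nontrivial H :=
  ⟨e 0, 0, e.orthonormal.ne_zero 0⟩

end Coordinates

section BackwardOrbit

variable {H : Type*} [NormedAddCommGroup H] [InnerProductSpace ℂ H]

/-- The backward orbits `m ↦ ∑ k, a k • (P k / P (k + m)) • e (k + m)` of the finitely supported
vectors `∑ k, a k • e k` under the backward shift with weights `w`, where `P = weightProd w`. -/
noncomputable def backwardOrbit (e : HilbertBasis ℕ ℂ H) (w : ℕ → ℝ) (m : ℕ) : (ℕ →₀ ℂ) →ₗ[ℂ] H :=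
  Finsupp.linearCombination ℂ
    fun k => ((weightProd w k / weightProd w (k + m) : ℝ) : ℂ) • e (k + m)

variable {e : HilbertBasis ℕ ℂ H} {w : ℕ → ℝ}

theorem backwardOrbit_single (e : HilbertBasis ℕ ℂ H) (w : ℕ → ℝ) (m k : ℕ) (c : ℂ) :
    backwardOrbit e w m (Finsupp.single k c) =
      c • ((weightProd w k / weightProd w (k + m) : ℝ) : ℂ) • e (k + m) :=
  Finsupp.linearCombination_single ..

theorem norm_backwardOrbit_single (hw : ∀ n, 0 < w n) (m k : ℕ) (c : ℂ) :
    ‖backwardOrbit e w m (Finsupp.single k c)‖ =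
      ‖c‖ * (weightProd w k / weightProd w (k + m)) := by
  rw [backwardOrbit_single, norm_smul, norm_smul, e.orthonormal.1, mul_one, Complex.norm_real,
    Real.norm_of_nonneg (div_pos (weightProd_pos hw _) (weightProd_pos hw _)).le]

theorem denseRange_backwardOrbit_zero (e : HilbertBasis ℕ ℂ H) (hw : ∀ n, 0 < w n) :
    DenseRange (backwardOrbit e w 0) := by
  have hzero : backwardOrbit e w 0 = Finsupp.linearCombination ℂ e := by
    simp only [backwardOrbit, add_zero, div_self (weightProd_pos hw _).ne', Complex.ofReal_one,
      one_smul]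
  rw [DenseRange, hzero, ← LinearMap.coe_range, Finsupp.range_linearCombination,
    Submodule.dense_iff_topologicalClosure_eq_top]
  exact e.dense_span

theorem tendsto_backwardOrbit {m : ℕ → ℕ} (hw : ∀ n, 0 < w n)
    (hP : ∀ k, Tendsto (fun i => weightProd w (k + m i)) atTop atTop) (a : ℕ →₀ ℂ) :
    Tendsto (fun i => backwardOrbit e w (m i) a) atTop (𝓝 0) := by
  induction a using Finsupp.induction_linear with
  | zero => simp only [map_zero, tendsto_const_nhds]
  | add a b ha hb => simpa only [map_add, add_zero] using ha.add hb
  | single k c =>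
    rw [tendsto_zero_iff_norm_tendsto_zero]
    simp only [norm_backwardOrbit_single hw]
    simpa using ((hP k).const_div_atTop (weightProd w k)).const_mul ‖c‖

theorem isBigO_backwardOrbit (hw : ∀ n, 0 < w n) {c ρ : ℝ} (hc : 0 < c) (hρ : 0 < ρ)
    (hP : ∀ n, c * ρ ^ n ≤ weightProd w n) (a : ℕ →₀ ℂ) :
    (fun m => backwardOrbit e w m a) =O[atTop] fun m => ρ⁻¹ ^ m := by
  induction a using Finsupp.induction_linear with
  | zero => simpa only [map_zero] using Asymptotics.isBigO_zero _ _
  | add a b ha hb => simpa only [map_add] using ha.add hb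
  | single k z =>
    refine Asymptotics.IsBigO.of_bound (‖z‖ * (weightProd w k / (c * ρ ^ k)))
      (Eventually.of_forall fun m => ?_)
    rw [norm_backwardOrbit_single hw, norm_pow, norm_inv, Real.norm_of_nonneg hρ.le]
    calc ‖z‖ * (weightProd w k / weightProd w (k + m))
        ≤ ‖z‖ * (weightProd w k / (c * ρ ^ (k + m))) := by
          gcongr
          exacts [(weightProd_pos hw k).le, hP _]
      _ = ‖z‖ * (weightProd w k / (c * ρ ^ k)) * ρ⁻¹ ^ m := by
          rw [pow_add, inv_pow]
          field_simp

end BackwardOrbit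

/-- `B` is the backward shift `e (n + 1) ↦ w n • e n`, `e 0 ↦ 0` with positive weights `w`. -/
structure IsBackwardShift {H : Type*} [NormedAddCommGroup H] [InnerProductSpace ℂ H]
    (e : HilbertBasis ℕ ℂ H) (w : ℕ → ℝ) (B : H →L[ℂ] H) : Prop where
  pos : ∀ n, 0 < w n
  repr_apply : ∀ x n, e.repr (B x) n = w n * e.repr x (n + 1)

theorem isBackwardShift_adjoint {H : Type*} [NormedAddCommGroup H] [InnerProductSpace ℂ H]
    [CompleteSpace H] (e : HilbertBasis ℕ ℂ H) {w : ℕ → ℝ} (hpos : ∀ n, 0 < w n)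
    (hbdd : ∃ C : ℝ, ∀ n, |w n| ≤ C) :
    IsBackwardShift e w (ContinuousLinearMap.adjoint (weightedShift e w)) where
  pos := hpos
  repr_apply x n := by
    rw [e.repr_apply_apply, ContinuousLinearMap.adjoint_inner_right,
      weightedShift_apply_basis e hbdd, inner_smul_left, e.repr_apply_apply, Complex.conj_ofReal]

namespace IsBackwardShift

variable {H : Type*} [NormedAddCommGroup H] [InnerProductSpace ℂ H]
  {e : HilbertBasis ℕ ℂ H} {w : ℕ → ℝ} {B : H →L[ℂ] H} (hB : IsBackwardShift e w B)

include hB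

theorem repr_pow_apply (m n : ℕ) (x : H) :
    (weightProd w n : ℂ) * e.repr ((B ^ m) x) n = weightProd w (n + m) * e.repr x (n + m) := by
  induction m generalizing x with
  | zero => rfl
  | succ m ih =>
    rw [pow_succ, mul_apply_eq_comp, ih, hB.repr_apply, ← add_assoc, weightProd_succ]
    push_cast
    ring

theorem weightProd_mul_norm_repr_pow (m n : ℕ) (x : H) :
    weightProd w n * ‖e.repr ((B ^ m) x) n‖ = weightProd w (n + m) * ‖e.repr x (n + m)‖ := by
  simpa [abs_of_pos, weightProd_pos hB.pos] using congrArg norm (hB.repr_pow_apply m n x)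

theorem norm_repr_pow_zero (m : ℕ) (x : H) :
    ‖e.repr ((B ^ m) x) 0‖ = weightProd w m * ‖e.repr x m‖ := by
  simpa [weightProd] using hB.weightProd_mul_norm_repr_pow m 0 x

theorem weightProd_add_le_opNorm_pow (k m : ℕ) :
    weightProd w (k + m) ≤ ‖B ^ m‖ * weightProd w k := by
  have hcoord : ‖e.repr ((B ^ m) (e (k + m))) k‖ ≤ ‖B ^ m‖ :=
    (norm_repr_le e _ k).trans ((B ^ m).unit_le_opNorm _ (e.orthonormal.1 _).le)
  have hpow := hB.weightProd_mul_norm_repr_pow m k (e (k + m))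
  rw [repr_basis_apply, if_pos rfl, norm_one, mul_one] at hpow
  rw [← hpow, mul_comm]
  exact mul_le_mul_of_nonneg_right hcoord (weightProd_pos hB.pos k).le

theorem bddAbove_range : BddAbove (range w) := by
  refine ⟨‖B‖, ?_⟩
  rintro _ ⟨n, rfl⟩
  have h := hB.weightProd_add_le_opNorm_pow n 1
  rw [weightProd_succ, pow_one, mul_comm] at h
  exact le_of_mul_le_mul_right h (weightProd_pos hB.pos n)

theorem apply_basis_zero : B (e 0) = 0 :=
  e.repr.injective <| lp.ext <| funext fun n => by
    simp [hB.repr_apply, repr_basis_apply]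

theorem apply_basis_succ (k : ℕ) : B (e (k + 1)) = (w k : ℂ) • e k :=
  e.repr.injective <| lp.ext <| funext fun n => by
    rw [hB.repr_apply, map_smul, lp.coeFn_smul, Pi.smul_apply, smul_eq_mul]
    rcases eq_or_ne n k with rfl | hn
    · simp [repr_basis_apply]
    · simp [repr_basis_apply, hn]

theorem pow_apply_basis_eq_zero {m k : ℕ} (h : k < m) : (B ^ m) (e k) = 0 := by
  induction k generalizing m with
  | zero =>
    obtain ⟨m, rfl⟩ := Nat.exists_eq_succ_of_ne_zero h.ne'
    rw [pow_succ, mul_apply_eq_comp, hB.apply_basis_zero, map_zero]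
  | succ k ih =>
    obtain ⟨m, rfl⟩ := Nat.exists_eq_succ_of_ne_zero (Nat.ne_zero_of_lt h)
    rw [pow_succ, mul_apply_eq_comp, hB.apply_basis_succ, map_smul, ih (by omega), smul_zero]

theorem apply_backwardOrbit_succ (m : ℕ) (a : ℕ →₀ ℂ) :
    B (backwardOrbit e w (m + 1) a) = backwardOrbit e w m a := by
  induction a using Finsupp.induction_linear with
  | zero => simp only [map_zero]
  | add a b ha hb => rw [map_add, map_add, map_add, ha, hb]
  | single k c =>
    have hwk : (w (k + m) : ℂ) ≠ 0 := Complex.ofReal_ne_zero.2 (hB.pos _).ne'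
    rw [backwardOrbit_single, backwardOrbit_single, map_smul, map_smul, ← add_assoc,
      hB.apply_basis_succ, smul_smul _ (w (k + m) : ℂ), weightProd_succ]
    congr 2
    push_cast
    field_simp

theorem eventually_pow_backwardOrbit_zero_eq_zero (a : ℕ →₀ ℂ) :
    ∀ᶠ n in atTop, (B ^ n) (backwardOrbit e w 0 a) = 0 := by
  induction a using Finsupp.induction_linear with
  | zero => simp only [map_zero, eventually_true]
  | add a b ha hb =>
    filter_upwards [ha, hb] with n hna hnb
    rw [map_add, map_add, hna, hnb, add_zero]
  | single k c =>
    filter_upwards [eventually_gt_atTop k] with n hn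
    rw [backwardOrbit_single, map_smul, map_smul, add_zero, hB.pow_apply_basis_eq_zero hn,
      smul_zero, smul_zero]

theorem isBackwardOrbitFamily : IsBackwardOrbitFamily B fun a m => backwardOrbit e w m a where
  denseRange := denseRange_backwardOrbit_zero e hB.pos
  apply_succ a m := hB.apply_backwardOrbit_succ m a
  eventually_pow_eq_zero := hB.eventually_pow_backwardOrbit_zero_eq_zero

theorem isTopologicallyMixing (hP : Tendsto (weightProd w) atTop atTop) :
    IsTopologicallyMixing B :=
  hB.isBackwardOrbitFamily.isTopologicallyMixing <| tendsto_backwardOrbit hB.pos fun k =>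
    hP.comp (tendsto_atTop_mono (fun n => Nat.le_add_left n k) tendsto_id)

theorem not_isHypercyclic (hP : BddAbove (range (weightProd w))) : ¬ IsHypercyclic B := by
  rintro ⟨x, hx⟩
  obtain ⟨K, hK⟩ := hP
  obtain ⟨_, ⟨n, rfl⟩, hn⟩ := hx.exists_mem_open (isOpen_setOf_lt_norm_repr e (K * ‖x‖) 0)
    (nonempty_setOf_lt_norm_repr e _ 0)
  refine (show K * ‖x‖ < ‖e.repr ((B ^ n) x) 0‖ from hn).not_ge ?_
  calc ‖e.repr ((B ^ n) x) 0‖ = weightProd w n * ‖e.repr x n‖ := hB.norm_repr_pow_zero n x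
    _ ≤ K * ‖x‖ := by
      gcongr
      exacts [(weightProd_pos hB.pos n).le.trans (hK (mem_range_self n)), hK (mem_range_self n),
        norm_repr_le e x n]

theorem not_isTopologicallyMixing (hP : ¬ Tendsto (weightProd w) atTop atTop) :
    ¬ IsTopologicallyMixing B := by
  refine fun h => hP (tendsto_atTop.2 fun K => ?_)
  obtain ⟨N, -, hN⟩ := h (Metric.ball 0 1) _ Metric.isOpen_ball ⟨0, by simp⟩
    (isOpen_setOf_lt_norm_repr e K 0) (nonempty_setOf_lt_norm_repr e K 0)
  filter_upwards [eventually_ge_atTop N] with m hm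
  obtain ⟨_, ⟨x, hx, rfl⟩, hK⟩ := hN m hm
  have hx1 : ‖e.repr x m‖ ≤ 1 := (norm_repr_le e x m).trans (mem_ball_zero_iff.1 hx).le
  calc K ≤ ‖e.repr ((B ^ m) x) 0‖ := le_of_lt hK
    _ = weightProd w m * ‖e.repr x m‖ := hB.norm_repr_pow_zero m x
    _ ≤ weightProd w m := mul_le_of_le_one_right (weightProd_pos hB.pos m).le hx1

theorem not_isChaotic (hP : ¬ Tendsto (weightProd w) atTop atTop) : ¬ IsChaotic B := by
  rintro ⟨-, hdense, -⟩
  obtain ⟨x, ⟨p, hp, hper⟩, hx⟩ := hdense.exists_mem_open (isOpen_setOf_lt_norm_repr e 0 0)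
    (nonempty_setOf_lt_norm_repr e 0 0)
  refine hP (tendsto_weightProd_of_syndetic hB.pos hB.bddAbove_range (L := p) fun K => ?_)
  have hsmall : ∀ᶠ m in atTop, K * ‖e.repr x m‖ < ‖e.repr x 0‖ :=
    ((tendsto_norm_repr e x).const_mul K).eventually_lt_const (by simpa using hx)
  obtain ⟨N, hN⟩ := eventually_atTop.1 hsmall
  filter_upwards [eventually_ge_atTop N] with n hn
  have hmod : n % p < p := Nat.mod_lt n hp
  obtain ⟨q, hq⟩ : p ∣ n + (p - n % p) := ⟨n / p + 1, by
    have := Nat.div_add_mod n p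
    rw [mul_add, mul_one]
    omega⟩
  have hfix : (B ^ (n + (p - n % p))) x = x := by
    rw [hq, pow_mul, FunLike.coe_pow_eq_iterate]
    exact Function.iterate_fixed hper q
  have hreturn := hB.norm_repr_pow_zero (n + (p - n % p)) x
  rw [hfix] at hreturn
  exact ⟨p - n % p, Nat.sub_le _ _, le_of_lt (lt_of_mul_lt_mul_right
    ((hN _ (by omega)).trans_eq hreturn) (norm_nonneg _))⟩

theorem norm_apply_le {C : ℝ} (hC : ∀ n, w n ≤ C) (x : H) : ‖B x‖ ≤ C * ‖x‖ := by
  have hC0 : 0 ≤ C := (hB.pos 0).le.trans (hC 0)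
  have hbound : ∀ n, ‖e.repr (B x) n‖ ^ 2 ≤ C ^ 2 * ‖e.repr x (n + 1)‖ ^ 2 := fun n => by
    rw [hB.repr_apply, norm_mul, Complex.norm_real, Real.norm_of_nonneg (hB.pos n).le, mul_pow]
    exact mul_le_mul_of_nonneg_right (pow_le_pow_left₀ (hB.pos n).le (hC n) 2) (by positivity)
  have htail := (hasSum_nat_add_iff' 1).2 (hasSum_sq_norm_repr e x)
  refine le_of_sq_le_sq ?_ (by positivity)
  calc ‖B x‖ ^ 2 ≤ C ^ 2 * (‖x‖ ^ 2 - ∑ i ∈ Finset.range 1, ‖e.repr x i‖ ^ 2) :=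
      hasSum_le hbound (hasSum_sq_norm_repr e (B x)) (htail.mul_left _)
    _ ≤ C ^ 2 * ‖x‖ ^ 2 := by
      gcongr
      exact sub_le_self _ (by positivity)
    _ = (C * ‖x‖) ^ 2 := (mul_pow _ _ 2).symm

theorem not_isLiYorkeChaotic (hw : ∀ n, w n ≤ 1) : ¬ IsLiYorkeChaotic B :=
  not_isLiYorkeChaotic_of_norm_le fun x => one_mul ‖x‖ ▸ hB.norm_apply_le hw x

variable [CompleteSpace H]

theorem isSupercyclic : IsSupercyclic B :=
  have := secondCountableTopology_of_hilbertBasis e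
  hB.isBackwardOrbitFamily.isSupercyclic

theorem isHypercyclic (hP : ¬ BddAbove (range (weightProd w))) : IsHypercyclic B := by
  have := secondCountableTopology_of_hilbertBasis e
  choose m hm hmP using exists_forall_le_weightProd_add hB.pos hB.bddAbove_range hP
  refine hB.isBackwardOrbitFamily.isHypercyclic (tendsto_atTop_mono hm tendsto_id)
    (tendsto_backwardOrbit hB.pos fun k => tendsto_atTop_mono' _ ?_ tendsto_natCast_atTop_atTop)
  filter_upwards [eventually_ge_atTop k] with i hi using hmP i k hi

theorem isChaotic {c ρ : ℝ} (hc : 0 < c) (hρ : 1 < ρ) (hP : ∀ n, c * ρ ^ n ≤ weightProd w n) :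
    IsChaotic B :=
  have := nontrivial_of_hilbertBasis e
  have hρ0 := one_pos.trans hρ
  hB.isBackwardOrbitFamily.isChaotic fun a => summable_of_isBigO_nat
    (summable_geometric_of_lt_one (inv_nonneg.2 hρ0.le) (inv_lt_one_of_one_lt₀ hρ))
    (isBigO_backwardOrbit hB.pos hc hρ0 hP a).norm_left

theorem isFrequentlyHypercyclic {c ρ : ℝ} (hc : 0 < c) (hρ : 1 < ρ)
    (hP : ∀ n, c * ρ ^ n ≤ weightProd w n) : IsFrequentlyHypercyclic B :=
  have := secondCountableTopology_of_hilbertBasis e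
  have hρ0 := one_pos.trans hρ
  hB.isBackwardOrbitFamily.isFrequentlyHypercyclic (inv_nonneg.2 hρ0.le)
    (inv_lt_one_of_one_lt₀ hρ) (isBigO_backwardOrbit hB.pos hc hρ0 hP)

theorem isLiYorkeChaotic {ρ : ℝ} (hρ : 1 < ρ) (hruns : ∀ L, ∃ k, ∀ i < L, ρ ≤ w (k + i)) :
    IsLiYorkeChaotic B := by
  have hzero : Dense {x : H | ∃ᶠ n in atTop, (B ^ n) x = 0} := by
    refine (denseRange_backwardOrbit_zero e hB.pos).mono ?_
    rintro _ ⟨a, rfl⟩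
    exact (hB.eventually_pow_backwardOrbit_zero_eq_zero a).frequently
  obtain ⟨x, hx⟩ := exists_isIrregularVector hzero fun ⟨K, hK⟩ => by
    obtain ⟨L, hL⟩ := pow_unbounded_of_one_lt K hρ
    obtain ⟨k, hk⟩ := hruns L
    have hgrowth : ρ ^ L ≤ ‖B ^ L‖ := le_of_mul_le_mul_right
      ((pow_mul_weightProd_le hB.pos (zero_le_one.trans hρ.le) hk).trans
        (hB.weightProd_add_le_opNorm_pow k L)) (weightProd_pos hB.pos k)
    exact absurd (hK (mem_range_self L)) (not_le.2 (hL.trans_le hgrowth))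
  exact hx.isLiYorkeChaotic

end IsBackwardShift

/-! ### Densities along an ultrafilter -/

/-- `c` is the limit of the averages of `φ` over `[1, N]` along a fixed free ultrafilter on `ℕ`.
Unlike limits along `atTop`, such means exist for every bounded `φ`, and they are additive. -/
def HasMean (φ : ℕ → ℝ) (c : ℝ) : Prop :=
  Tendsto (fun N : ℕ => (∑ m ∈ Finset.Icc 1 N, φ m) / N) (hyperfilter ℕ : Filter ℕ) (𝓝 c)

/-- `S` has density `d` along the ultrafilter used in `HasMean`. -/
def HasDensity (S : Set ℕ) (d : ℝ) : Prop := HasMean (S.indicator 1) d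

theorem exists_hasMean {φ : ℕ → ℝ} {C : ℝ} (hφ : ∀ m, |φ m| ≤ C) : ∃ c, HasMean φ c := by
  have hmem (N : ℕ) : (∑ m ∈ Finset.Icc 1 N, φ m) / N ∈ Icc (-C) C := by
    have hsum : |∑ m ∈ Finset.Icc 1 N, φ m| ≤ N * C := by
      simpa using (Finset.abs_sum_le_sum_abs _ _).trans
        (Finset.sum_le_card_nsmul (Finset.Icc 1 N) _ C fun m _ => hφ m)
    refine mem_Icc.2 (abs_le.1 ?_)
    rw [abs_div, Nat.abs_cast]
    exact div_le_of_le_mul₀ N.cast_nonneg ((abs_nonneg _).trans (hφ 0)) (by rwa [mul_comm])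
  obtain ⟨c, -, hc⟩ := isCompact_Icc.ultrafilter_le_nhds
    ((hyperfilter ℕ).map fun N : ℕ => (∑ m ∈ Finset.Icc 1 N, φ m) / N)
    (le_principal_iff.2 (Ultrafilter.mem_map.2 (univ_mem' hmem)))
  exact ⟨c, hc⟩

namespace HasMean

variable {φ ψ : ℕ → ℝ} {a b : ℝ}

theorem const (a : ℝ) : HasMean (fun _ => a) a := by
  refine (tendsto_const_nhds.congr' ?_).mono_left Nat.hyperfilter_le_atTop
  filter_upwards [eventually_gt_atTop 0] with N hN
  rw [Finset.sum_const, Nat.card_Icc, Nat.add_sub_cancel, nsmul_eq_mul,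
    mul_div_cancel_left₀ a (Nat.cast_ne_zero.2 hN.ne')]

theorem unique (ha : HasMean φ a) (hb : HasMean φ b) : a = b :=
  tendsto_nhds_unique ha hb

theorem add (hφ : HasMean φ a) (hψ : HasMean ψ b) : HasMean (fun m => φ m + ψ m) (a + b) :=
  (Tendsto.add hφ hψ).congr fun N => by rw [Finset.sum_add_distrib, add_div]

theorem const_mul (t : ℝ) (hφ : HasMean φ a) : HasMean (fun m => t * φ m) (t * a) :=
  (Tendsto.const_mul t hφ).congr fun N => by rw [← Finset.mul_sum, mul_div_assoc]

theorem sum {ι : Type*} (s : Finset ι) {φ : ι → ℕ → ℝ} {a : ι → ℝ}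
    (h : ∀ i ∈ s, HasMean (φ i) (a i)) : HasMean (fun m => ∑ i ∈ s, φ i m) (∑ i ∈ s, a i) :=
  (tendsto_finsetSum s h).congr fun N => by rw [Finset.sum_comm, Finset.sum_div]

theorem le (hφ : HasMean φ a) (hψ : HasMean ψ b) (h : ∀ m, φ m ≤ ψ m) : a ≤ b :=
  le_of_tendsto_of_tendsto' hφ hψ fun N =>
    div_le_div_of_nonneg_right (Finset.sum_le_sum fun m _ => h m) N.cast_nonneg

theorem comp_add_one {C : ℝ} (hφ : HasMean φ a) (hC : ∀ m, |φ m| ≤ C) :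
    HasMean (fun m => φ (m + 1)) a := by
  have hboundary : Tendsto (fun N : ℕ => (φ (N + 1) - φ 1) / (N : ℝ)) (hyperfilter ℕ : Filter ℕ)
      (𝓝 0) := by
    refine Tendsto.mono_left (squeeze_zero_norm (fun N => ?_)
      (tendsto_const_div_atTop_nhds_zero_nat (C + C))) Nat.hyperfilter_le_atTop
    rw [norm_div, Real.norm_natCast]
    exact div_le_div_of_nonneg_right ((abs_sub _ _).trans (add_le_add (hC _) (hC _)))
      N.cast_nonneg
  have htelescope (N : ℕ) : ∑ m ∈ Finset.Icc 1 N, φ (m + 1) =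
      ∑ m ∈ Finset.Icc 1 N, φ m + (φ (N + 1) - φ 1) := by
    induction N with
    | zero => simp
    | succ N ih =>
      rw [Finset.sum_Icc_succ_top (by omega), ih, Finset.sum_Icc_succ_top (by omega)]
      ring
  have h := Tendsto.add hφ hboundary
  rw [add_zero] at h
  exact h.congr fun N => by rw [htelescope, add_div]

theorem comp_add {C : ℝ} (hφ : HasMean φ a) (hC : ∀ m, |φ m| ≤ C) (s : ℕ) :
    HasMean (fun m => φ (m + s)) a := by
  induction s with
  | zero => exact hφ
  | succ s ih =>
    simpa only [add_assoc, add_comm 1 s] using ih.comp_add_one fun m => hC (m + s)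

end HasMean

theorem abs_indicator_one_le_one (S : Set ℕ) (m : ℕ) : |S.indicator (1 : ℕ → ℝ) m| ≤ 1 := by
  by_cases h : m ∈ S <;> simp [h]

theorem exists_hasDensity (S : Set ℕ) : ∃ d, HasDensity S d :=
  exists_hasMean (abs_indicator_one_le_one S)

theorem exists_pos_hasDensity {S : Set ℕ} (hS : 0 < lowerDensity S) :
    ∃ d > 0, HasDensity S d := by
  classical
  obtain ⟨d, hd⟩ := exists_hasDensity S
  refine ⟨d, (half_pos hS).trans_le (ge_of_tendsto hd (Nat.hyperfilter_le_atTop ?_)), hd⟩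
  have hev : ∀ᶠ n : ℕ in atTop, lowerDensity S / 2 < ((S ∩ Icc 1 n).ncard : ℝ) / n :=
    eventually_lt_of_lt_liminf (half_lt_self hS) (isBoundedUnder_of ⟨0, fun n => by positivity⟩)
  filter_upwards [hev] with n hn
  have hcard : ((S ∩ Icc 1 n).ncard : ℝ) = ∑ m ∈ Finset.Icc 1 n, S.indicator 1 m := by
    have hinter : S ∩ Icc 1 n = ((Finset.Icc 1 n).filter (· ∈ S) : Finset ℕ) := by
      ext; simp; tauto
    simp only [hinter, ncard_coe_finset, indicator_apply, Pi.one_apply, Finset.sum_boole]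
  exact hcard ▸ hn.le

theorem HasDensity.preimage_add {S : Set ℕ} {d : ℝ} (hS : HasDensity S d) (s : ℕ) :
    HasDensity ((· + s) ⁻¹' S) d :=
  hS.comp_add (abs_indicator_one_le_one S) s

theorem summable_mul_of_hasDensity {T : ℕ → Set ℕ} {b c : ℕ → ℝ} {M : ℝ} (hb : ∀ k, 0 ≤ b k)
    (hT : ∀ k, HasDensity (T k) (c k))
    (hM : ∀ (F : Finset ℕ) (m : ℕ), ∑ k ∈ F, b k * (T k).indicator 1 m ≤ M) :
    Summable fun k => b k * c k := by
  have hc (k : ℕ) : 0 ≤ c k :=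
    (HasMean.const 0).le (hT k) fun m => indicator_nonneg (fun _ _ => zero_le_one) m
  exact summable_of_sum_le (fun k => mul_nonneg (hb k) (hc k)) fun F =>
    (HasMean.sum F fun k _ => (hT k).const_mul (b k)).le (HasMean.const M) (hM F)

theorem exists_ne_le_density_inter {T : ℕ → Set ℕ} {d : ℝ} {q : ℕ → ℕ → ℝ} (hd : 0 < d)
    (hT : ∀ i, HasDensity (T i) d) (hq : ∀ i j, HasDensity (T i ∩ T j) (q i j)) :
    ∃ i j, i ≠ j ∧ d ^ 2 / 2 ≤ q i j := by
  by_contra! hsmall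
  have hdiag (i : ℕ) : q i i = d := (inter_self (T i) ▸ hq i i).unique (hT i)
  have hq_le (i j : ℕ) : q i j ≤ d ^ 2 / 2 + if i = j then d else 0 := by
    split_ifs with h
    · rw [← h, hdiag]
      exact le_add_of_nonneg_left (by positivity)
    · simpa using (hsmall i j h).le
  obtain ⟨r, hr⟩ := exists_nat_gt (2 / d)
  rw [div_lt_iff₀ hd] at hr
  have hlower : 2 * (r * d) * (r * d) + -(r * d) ^ 2 ≤
      ∑ i ∈ Finset.range r, ∑ j ∈ Finset.range r, q i j := by
    have hmean : HasMean (fun m => ∑ i ∈ Finset.range r, (T i).indicator 1 m) (r * d) := by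
      simpa using HasMean.sum (Finset.range r) fun i _ => hT i
    refine ((hmean.const_mul (2 * (r * d))).add (HasMean.const (-(r * d) ^ 2))).le
      (HasMean.sum _ fun i _ => HasMean.sum _ fun j _ => hq i j) fun m => ?_
    simp only [inter_indicator_one, Pi.mul_apply, ← Finset.sum_mul_sum]
    linarith [sq_nonneg ((∑ i ∈ Finset.range r, (T i).indicator (1 : ℕ → ℝ) m) - r * d)]
  have hupper : ∑ i ∈ Finset.range r, ∑ j ∈ Finset.range r, q i j ≤
      r * (r * (d ^ 2 / 2)) + r * d :=
    calc _ ≤ ∑ i ∈ Finset.range r, ∑ j ∈ Finset.range r, (d ^ 2 / 2 + if i = j then d else 0) :=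
          Finset.sum_le_sum fun i _ => Finset.sum_le_sum fun j _ => hq_le i j
      _ = r * (r * (d ^ 2 / 2)) + r * d := by
          have hdiagonal (i : ℕ) (hi : i ∈ Finset.range r) :
              ∑ j ∈ Finset.range r, (if i = j then d else 0) = d := by
            rw [Finset.sum_ite_eq, if_pos hi]
          simp only [Finset.sum_add_distrib, Finset.sum_congr rfl hdiagonal, Finset.sum_const,
            Finset.card_range, nsmul_eq_mul]
  nlinarith

theorem exists_syndetic_le_density_inter {S : Set ℕ} {c : ℕ → ℝ} (hS : 0 < lowerDensity S)
    (hc : ∀ k, HasDensity (S ∩ (· + k) ⁻¹' S) (c k)) :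
    ∃ δ > 0, ∃ L : ℕ, ∀ n, ∃ a ≤ L, δ ≤ c (n + a) := by
  obtain ⟨d, hd, hSd⟩ := exists_pos_hasDensity hS
  refine ⟨d ^ 2 / 2, by positivity, ?_⟩
  by_contra! hgap
  choose gap hgap using hgap
  -- Every difference `s j - s i` with `i < j` lies in the gap that starts at `s (j - 1)`.
  let s : ℕ → ℕ := fun i => Nat.rec 0 (fun _ x => gap x + x) i
  have hs_mono : Monotone s := monotone_nat_of_le_succ fun i => Nat.le_add_left _ _
  have hs_lt {i j : ℕ} (hij : i < j) : c (s j - s i) < d ^ 2 / 2 := by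
    obtain ⟨j, rfl⟩ := Nat.exists_eq_succ_of_ne_zero (Nat.ne_zero_of_lt hij)
    have hle := hs_mono (Nat.lt_succ_iff.1 hij)
    rw [show s (j + 1) - s i = gap (s j) + (s j - s i) from Nat.add_sub_assoc hle _]
    exact hgap _ _ (Nat.sub_le _ _)
  have hdensity {i j : ℕ} (hij : i < j) :
      HasDensity ((· + s i) ⁻¹' S ∩ (· + s j) ⁻¹' S) (c (s j - s i)) := by
    convert (hc (s j - s i)).preimage_add (s i) using 1
    ext m
    have hsum : m + s i + (s j - s i) = m + s j := by have := hs_mono hij.le; omega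
    simp only [mem_inter_iff, mem_preimage, hsum]
  choose q hq using fun i j => exists_hasDensity ((· + s i) ⁻¹' S ∩ (· + s j) ⁻¹' S)
  obtain ⟨i, j, hij, hle⟩ := exists_ne_le_density_inter hd (fun i => hSd.preimage_add (s i)) hq
  rcases hij.lt_or_gt with hij | hij
  · exact ((hq i j).unique (hdensity hij) ▸ hle).not_gt (hs_lt hij)
  · exact ((hq i j).unique (inter_comm _ _ ▸ hdensity hij) ▸ hle).not_gt (hs_lt hij)

namespace IsBackwardShift

variable {H : Type*} [NormedAddCommGroup H] [InnerProductSpace ℂ H]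
  {e : HilbertBasis ℕ ℂ H} {w : ℕ → ℝ} {B : H →L[ℂ] H} (hB : IsBackwardShift e w B)

include hB

theorem sum_inv_sq_weightProd_le {x : H} {F : Finset ℕ}
    (hF : ∀ k ∈ F, ‖(B ^ k) x - e 0‖ ≤ 1 / 2) :
    ∑ k ∈ F, (weightProd w k ^ 2)⁻¹ ≤ 4 * ‖x‖ ^ 2 := by
  have hcoord (k : ℕ) (hk : k ∈ F) : (weightProd w k ^ 2)⁻¹ ≤ 4 * ‖e.repr x k‖ ^ 2 := by
    have hpos := weightProd_pos hB.pos k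
    have hnear := (norm_repr_le e ((B ^ k) x - e 0) 0).trans (hF k hk)
    rw [map_sub, lp.coeFn_sub, Pi.sub_apply, repr_basis_apply, if_pos rfl, norm_sub_rev] at hnear
    have hhalf : 1 / 2 ≤ weightProd w k * ‖e.repr x k‖ := by
      rw [← hB.norm_repr_pow_zero]
      linarith [norm_sub_norm_le (1 : ℂ) (e.repr ((B ^ k) x) 0), norm_one (α := ℂ)]
    rw [inv_le_iff_one_le_mul₀ (by positivity)]
    nlinarith
  calc ∑ k ∈ F, (weightProd w k ^ 2)⁻¹ ≤ ∑ k ∈ F, 4 * ‖e.repr x k‖ ^ 2 := Finset.sum_le_sum hcoord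
    _ ≤ 4 * ‖x‖ ^ 2 := by
      rw [← Finset.mul_sum]
      gcongr
      exact sum_le_hasSum F (fun _ _ => by positivity) (hasSum_sq_norm_repr e x)

theorem summable_inv_sq_weightProd_mul {x : H} {S : Set ℕ} {c : ℕ → ℝ}
    (hS : ∀ k ∈ S, ‖(B ^ k) x - e 0‖ ≤ 1 / 2)
    (hc : ∀ k, HasDensity (S ∩ (· + k) ⁻¹' S) (c k)) :
    Summable fun k => (weightProd w k ^ 2)⁻¹ * c k := by
  classical
  refine summable_mul_of_hasDensity (M := 9) (fun k => by positivity) hc fun F m => ?_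
  by_cases hm : m ∈ S
  · have hnorm : ‖(B ^ m) x‖ ≤ 3 / 2 := by
      linarith [norm_le_norm_sub_add ((B ^ m) x) (e 0), hS m hm, e.orthonormal.1 0]
    calc ∑ k ∈ F, (weightProd w k ^ 2)⁻¹ * (S ∩ (· + k) ⁻¹' S).indicator 1 m
        = ∑ k ∈ F with m + k ∈ S, (weightProd w k ^ 2)⁻¹ := by
          simp [Finset.sum_filter, indicator_apply, hm]
      _ ≤ 4 * ‖(B ^ m) x‖ ^ 2 := hB.sum_inv_sq_weightProd_le fun k hk => by
          rw [← mul_apply_eq_comp, ← pow_add, add_comm k m]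
          exact hS _ (Finset.mem_filter.1 hk).2
      _ ≤ 9 := by nlinarith [norm_nonneg ((B ^ m) x)]
  · simp [hm]

theorem not_isFrequentlyHypercyclic (hP : ¬ Tendsto (weightProd w) atTop atTop) :
    ¬ IsFrequentlyHypercyclic B := by
  rintro ⟨x, hx⟩
  let S : Set ℕ := {k | (B ^ k) x ∈ Metric.ball (e 0) (1 / 2)}
  have hS : ∀ k ∈ S, ‖(B ^ k) x - e 0‖ ≤ 1 / 2 := fun k hk => (mem_ball_iff_norm.1 hk).le
  choose c hc using fun k => exists_hasDensity (S ∩ (· + k) ⁻¹' S)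
  obtain ⟨δ, hδ, L, hL⟩ := exists_syndetic_le_density_inter
    (hx _ Metric.isOpen_ball ⟨e 0, Metric.mem_ball_self one_half_pos⟩) hc
  refine hP (tendsto_weightProd_of_syndetic hB.pos hB.bddAbove_range (L := L) fun K => ?_)
  have hpos : 0 < ((|K| + 1) ^ 2)⁻¹ * δ := by positivity
  obtain ⟨N, hN⟩ := eventually_atTop.1 ((hB.summable_inv_sq_weightProd_mul hS
    hc).tendsto_atTop_zero.eventually_lt_const hpos)
  filter_upwards [eventually_ge_atTop N] with n hn
  obtain ⟨a, ha, hδa⟩ := hL n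
  refine ⟨a, ha, ?_⟩
  have hPa := weightProd_pos hB.pos (n + a)
  have hinv : (weightProd w (n + a) ^ 2)⁻¹ < ((|K| + 1) ^ 2)⁻¹ := by
    refine lt_of_mul_lt_mul_right (lt_of_le_of_lt ?_ (hN (n + a) (by omega))) hδ.le
    exact mul_le_mul_of_nonneg_left hδa (by positivity)
  have hlt : |K| + 1 < weightProd w (n + a) :=
    lt_of_pow_lt_pow_left₀ 2 hPa.le ((inv_lt_inv₀ (by positivity) (by positivity)).1 hinv)
  linarith [le_abs_self K]

end IsBackwardShift

/-! ### Independent and identically distributed sequences -/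

/-- The variables `ξ n` are independent and all distributed as `ξ 0`. -/
structure IsIID {Ω β : Type*} [MeasurableSpace Ω] [MeasurableSpace β] (ξ : ℕ → Ω → β)
    (μ : Measure Ω) : Prop where
  measurable (n : ℕ) : Measurable (ξ n)
  iIndepFun : iIndepFun ξ μ
  identDistrib (n : ℕ) : IdentDistrib (ξ n) (ξ 0) μ μ

namespace IsIID

variable {Ω β : Type*} [MeasurableSpace Ω] [MeasurableSpace β] {ξ : ℕ → Ω → β} {μ : Measure Ω}
  {A : Set β} {D : Set (ℕ → β)} (hξ : IsIID ξ μ)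

include hξ

theorem comp {γ : Type*} [MeasurableSpace γ] {g : β → γ} (hg : Measurable g) :
    IsIID (fun n ω => g (ξ n ω)) μ where
  measurable n := hg.comp (hξ.measurable n)
  iIndepFun := hξ.iIndepFun.comp (fun _ => g) fun _ => hg
  identDistrib n := (hξ.identDistrib n).comp hg

theorem ae_forall_mem (hA : MeasurableSet A) (h : ∀ᵐ ω ∂μ, ξ 0 ω ∈ A) :
    ∀ᵐ ω ∂μ, ∀ n, ξ n ω ∈ A :=
  ae_all_iff.2 fun n => (hξ.identDistrib n).symm.ae_snd hA h

theorem measure_shift_mem (hD : MeasurableSet D) (k : ℕ) :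
    μ {ω | (fun i => ξ (k + i) ω) ∈ D} = μ {ω | (fun i => ξ i ω) ∈ D} := by
  have hlaw (k : ℕ) : μ.map (fun ω i => ξ (k + i) ω) = Measure.infinitePi fun _ => μ.map (ξ 0) := by
    rw [(hξ.iIndepFun.precomp (add_right_injective k)).map_fun_eq_infinitePi_map
      fun i => hξ.measurable (k + i)]
    exact congrArg _ (funext fun i => (hξ.identDistrib (k + i)).map_eq)
  have hmeas (k : ℕ) : Measurable fun ω i => ξ (k + i) ω :=
    measurable_pi_iff.2 fun i => hξ.measurable (k + i)
  have hmap (k : ℕ) : μ {ω | (fun i => ξ (k + i) ω) ∈ D} =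
      Measure.infinitePi (fun _ => μ.map (ξ 0)) D := by
    rw [← hlaw k, Measure.map_apply (hmeas k) hD]
    rfl
  simpa only [zero_add] using (hmap k).trans (hmap 0).symm

theorem indepFun_zero_shift : IndepFun (ξ 0) (fun ω i => ξ (1 + i) ω) μ := by
  have hle {S : Set ℕ} {n : ℕ} (hn : n ∈ S) : MeasurableSpace.comap (ξ n) inferInstance ≤
      ⨆ n ∈ S, MeasurableSpace.comap (ξ n) inferInstance :=
    le_iSup₂ (f := fun n (_ : n ∈ S) => MeasurableSpace.comap (ξ n) inferInstance) n hn
  have htail : MeasurableSpace.comap (fun ω i => ξ (1 + i) ω) inferInstance ≤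
      ⨆ n ∈ Ici 1, MeasurableSpace.comap (ξ n) inferInstance :=
    MeasurableSpace.comap_iSup.trans_le <| iSup_le fun i =>
      MeasurableSpace.comap_comp.trans_le (hle (Nat.le_add_right 1 i))
  exact indep_of_indep_of_le_left (indep_of_indep_of_le_right
    (indep_iSup_of_disjoint (fun n => (hξ.measurable n).comap_le) hξ.iIndepFun
      (S := {0}) (T := Ici 1) (by simp)) htail) (hle rfl)

theorem measure_zero_mem_and_shift_mem (hA : MeasurableSet A) (hD : MeasurableSet D) :
    μ {ω | ξ 0 ω ∈ A ∧ (fun i => ξ (1 + i) ω) ∈ D} =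
      μ {ω | ξ 0 ω ∈ A} * μ {ω | (fun i => ξ i ω) ∈ D} := by
  rw [← hξ.measure_shift_mem hD 1]
  exact hξ.indepFun_zero_shift.measure_inter_preimage_eq_mul A D hA hD

theorem measure_forall_lt_mem_and_shift_mem (hA : MeasurableSet A) (hD : MeasurableSet D)
    (m : ℕ) :
    μ {ω | (∀ i < m, ξ i ω ∈ A) ∧ (fun i => ξ (m + i) ω) ∈ D} =
      μ {ω | ξ 0 ω ∈ A} ^ m * μ {ω | (fun i => ξ i ω) ∈ D} := by
  induction m with
  | zero => simp
  | succ m ih =>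
    have hmeas : MeasurableSet {x : ℕ → β | (∀ i < m, x i ∈ A) ∧ (fun i => x (m + i)) ∈ D} := by
      simp only [ofPred_and, ofPred_forall]
      measurability
    rw [pow_succ', mul_assoc, ← ih]
    refine Eq.trans (congrArg μ ?_) (hξ.measure_zero_mem_and_shift_mem hA hmeas)
    ext ω
    simp only [mem_ofPred_eq, Nat.forall_lt_succ_left, and_assoc, add_comm 1, Nat.add_right_comm]

/-- Prefixing `L` terms in `A` to a path without such a run yields a path that has one; but the
paths whose `L`-th shift has no run are, by stationarity, almost surely without a run. -/
theorem ae_exists_run [IsFiniteMeasure μ] (hA : MeasurableSet A)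
    (hpos : μ {ω | ξ 0 ω ∈ A} ≠ 0) (L : ℕ) :
    ∀ᵐ ω ∂μ, ∃ k, ∀ i < L, ξ (k + i) ω ∈ A := by
  let N : Set (ℕ → β) := {x | ∀ k, ∃ i < L, x (k + i) ∉ A}
  have hN : MeasurableSet N := by
    simp only [N, ofPred_forall, ofPred_exists]
    measurability
  have hsub : {ω | (∀ i < L, ξ i ω ∈ A) ∧ (fun i => ξ (L + i) ω) ∈ N} ⊆
      {ω | (fun i => ξ (L + i) ω) ∈ N} \ {ω | (fun i => ξ i ω) ∈ N} := by
    rintro ω ⟨hrun, hω⟩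
    refine ⟨hω, fun hω' => ?_⟩
    obtain ⟨i, hi, hiA⟩ := hω' 0
    exact hiA (by simpa using hrun i hi)
  have hmono : {ω | (fun i => ξ i ω) ∈ N} ⊆ {ω | (fun i => ξ (L + i) ω) ∈ N} := fun ω hω k => by
    simpa only [add_assoc] using hω (L + k)
  have hmeas : MeasurableSet {ω | (fun i => ξ i ω) ∈ N} := measurable_pi_iff.2 hξ.measurable hN
  have hzero := measure_mono hsub (μ := μ)
  rw [hξ.measure_forall_lt_mem_and_shift_mem hA hN, measure_sdiff hmono hmeas.nullMeasurableSet
    (measure_ne_top μ _), hξ.measure_shift_mem hN, tsub_self, nonpos_iff_eq_zero, mul_eq_zero,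
    or_iff_right (pow_ne_zero L hpos)] at hzero
  filter_upwards [measure_eq_zero_iff_ae_notMem.1 hzero] with ω hω
  by_contra! h
  exact hω h

end IsIID

/-! ### Random walks -/

theorem exists_linear_le {S : ℕ → ℝ} {a c : ℝ} (hS : Tendsto (fun n : ℕ => S n / n) atTop (𝓝 c))
    (ha : a < c) : ∃ b, ∀ n : ℕ, a * n + b ≤ S n := by
  have hev : ∀ᶠ n : ℕ in atTop, a * n - S n ≤ 0 := by
    filter_upwards [hS.eventually_const_lt ha, eventually_gt_atTop 0] with n hn hn0
    exact sub_nonpos.2 ((lt_div_iff₀ (Nat.cast_pos.2 hn0)).1 hn).le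
  obtain ⟨b, hb⟩ := IsBoundedUnder.bddAbove_range ⟨0, eventually_map.2 hev⟩
  exact ⟨-b, fun n => by linarith [hb ⟨n, rfl⟩]⟩

theorem exists_le_linear {S : ℕ → ℝ} {a c : ℝ} (hS : Tendsto (fun n : ℕ => S n / n) atTop (𝓝 c))
    (ha : c < a) : ∃ b, ∀ n : ℕ, S n ≤ a * n + b := by
  obtain ⟨b, hb⟩ := exists_linear_le (S := fun n => -S n)
    (by simpa only [neg_div] using hS.neg) (neg_lt_neg ha)
  exact ⟨-b, fun n => by linarith [hb n]⟩

theorem exists_mul_card_le_sub {S : ℕ → ℝ} {δ : ℝ} (F : Finset ℕ)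
    (hF : ∀ k ∈ F, ∀ m > k, S k + δ ≤ S m) {n : ℕ} (hn : ∀ k ∈ F, k < n) :
    ∃ j ≤ n, δ * F.card ≤ S n - S j := by
  induction F using Finset.induction_on_max generalizing n with
  | empty => exact ⟨n, le_rfl, by simp⟩
  | insert k F hk ih =>
    have hkn := hn k (Finset.mem_insert_self k F)
    obtain ⟨j, hj, hle⟩ := ih (fun i hi => hF i (Finset.mem_insert_of_mem hi)) hk
    refine ⟨j, hj.trans hkn.le, ?_⟩
    rw [Finset.card_insert_of_notMem fun h => (hk k h).false, Nat.cast_succ]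
    linarith [hF k (Finset.mem_insert_self k F) n hkn]

theorem tendsto_sum_indicator_div {S : ℕ → ℝ} (hS : Tendsto (fun n : ℕ => S n / n) atTop (𝓝 0))
    {K : Set ℕ} {δ : ℝ} (hδ : 0 < δ) (hK : ∀ k ∈ K, ∀ m > k, S k + δ ≤ S m) :
    Tendsto (fun n : ℕ => (∑ k ∈ Finset.range n, K.indicator 1 k) / (n : ℝ)) atTop (𝓝 0) := by
  classical
  refine tendsto_order.2 ⟨fun a ha => .of_forall fun n => ha.trans_le <| div_nonneg
    (Finset.sum_nonneg fun k _ => indicator_nonneg (fun _ _ => zero_le_one) k) n.cast_nonneg,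
    fun a ha => ?_⟩
  have hε : 0 < a * δ / 3 := by positivity
  obtain ⟨b, hb⟩ := exists_linear_le hS (neg_lt_zero.2 hε)
  obtain ⟨b', hb'⟩ := exists_le_linear hS hε
  have hlarge : Tendsto (fun n : ℕ => a * δ / 3 * n) atTop atTop :=
    tendsto_natCast_atTop_atTop.const_mul_atTop hε
  filter_upwards [eventually_gt_atTop 0, hlarge.eventually_gt_atTop (b' - b)] with n hn0 hn
  obtain ⟨j, hj, hcard⟩ := exists_mul_card_le_sub ((Finset.range n).filter (· ∈ K))
    (fun k hk => hK k (Finset.mem_filter.1 hk).2)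
    (fun k hk => Finset.mem_range.1 (Finset.mem_filter.1 hk).1)
  simp only [indicator_apply, Pi.one_apply, Finset.sum_boole]
  rw [div_lt_iff₀ (Nat.cast_pos.2 hn0)]
  refine lt_of_mul_lt_mul_left (hcard.trans_lt ?_) hδ.le
  have hjn : a * δ / 3 * j ≤ a * δ / 3 * n :=
    mul_le_mul_of_nonneg_left (Nat.cast_le.2 hj) hε.le
  linarith [hb j, hb' n]

/-- The sequences of steps whose partial sums, the empty one excepted, all exceed `δ`. -/
def escapePaths (δ : ℝ) : Set (ℕ → ℝ) := {x | ∀ m, δ < ∑ i ∈ Finset.range (m + 1), x i}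

theorem measurableSet_escapePaths (δ : ℝ) : MeasurableSet (escapePaths δ) := by
  simp only [escapePaths, ofPred_forall]
  exact MeasurableSet.iInter fun m => measurableSet_lt measurable_const (by fun_prop)

theorem exists_measure_lt_neg_ne_zero {Ω : Type*} [MeasurableSpace Ω] {μ : Measure Ω} {Y : Ω → ℝ}
    (hint : Integrable Y μ) (hzero : ∫ ω, Y ω ∂μ = 0) (hne : ¬ Y =ᵐ[μ] 0) :
    ∃ η > 0, μ {ω | Y ω < -η} ≠ 0 := by
  by_contra! hcon
  have hnonneg : 0 ≤ᵐ[μ] Y := by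
    filter_upwards [ae_all_iff.2 fun n : ℕ => measure_eq_zero_iff_ae_notMem.1
      (hcon (1 / (n + 1)) (by positivity))] with ω hω
    by_contra! hlt
    obtain ⟨n, hn⟩ := exists_nat_one_div_lt (neg_pos.2 hlt)
    exact hω n (lt_neg_of_lt_neg hn)
  exact hne ((integral_eq_zero_iff_of_nonneg_ae hnonneg hint).1 hzero)

namespace IsIID

variable {Ω : Type*} [MeasurableSpace Ω] {ξ : ℕ → Ω → ℝ} {μ : Measure Ω} (hξ : IsIID ξ μ)

include hξ

theorem ae_tendsto_sum_div (hint : Integrable (ξ 0) μ) :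
    ∀ᵐ ω ∂μ, Tendsto (fun n : ℕ => (∑ i ∈ Finset.range n, ξ i ω) / n) atTop (𝓝 (∫ ω, ξ 0 ω ∂μ)) :=
  strong_law_ae_real ξ hint (fun _ _ hij => hξ.iIndepFun.indepFun hij) hξ.identDistrib

/-- By stationarity the measure of the escape event is the expected frequency of the times after
which the walk escapes; each of these times lifts the walk by `δ`, while the walk is `o(n)`. -/
theorem measure_escapePaths_eq_zero [IsFiniteMeasure μ] (hint : Integrable (ξ 0) μ)
    (hzero : ∫ ω, ξ 0 ω ∂μ = 0) {δ : ℝ} (hδ : 0 < δ) :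
    μ {ω | (fun i => ξ i ω) ∈ escapePaths δ} = 0 := by
  let U (k : ℕ) : Set Ω := {ω | (fun i => ξ (k + i) ω) ∈ escapePaths δ}
  have hU (k : ℕ) : MeasurableSet (U k) :=
    measurable_pi_iff.2 (fun i => hξ.measurable (k + i)) (measurableSet_escapePaths δ)
  have hlim : ∀ᵐ ω ∂μ, Tendsto
      (fun n : ℕ => (∑ k ∈ Finset.range n, (U k).indicator 1 ω) / (n : ℝ)) atTop (𝓝 0) := by
    filter_upwards [hξ.ae_tendsto_sum_div hint] with ω hω
    rw [hzero] at hω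
    refine tendsto_sum_indicator_div hω (K := {k | ω ∈ U k}) hδ fun k hk m hm => ?_
    obtain ⟨d, rfl⟩ := Nat.exists_eq_add_of_lt hm
    rw [add_assoc, Finset.sum_range_add]
    exact add_le_add_right (hk d).le _
  have hbound (n : ℕ) (ω : Ω) :
      ‖(∑ k ∈ Finset.range n, (U k).indicator (1 : Ω → ℝ) ω) / (n : ℝ)‖ ≤ 1 := by
    rw [norm_div, Real.norm_natCast]
    exact div_le_one_of_le₀ ((norm_sum_le_of_le (Finset.range n) (n := fun _ => 1) fun k _ =>
      (norm_indicator_le_norm_self (1 : Ω → ℝ) ω).trans_eq norm_one).trans_eq (by simp))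
      n.cast_nonneg
  have hfreq := tendsto_integral_of_dominated_convergence (fun _ => (1 : ℝ))
    (fun n => ((Finset.measurable_sum _ fun k _ =>
      measurable_one.indicator (hU k)).div_const _).aestronglyMeasurable)
    (integrable_const _) (fun n => .of_forall (hbound n)) hlim
  have hmean : ∀ᶠ n : ℕ in atTop,
      ∫ ω, (∑ k ∈ Finset.range n, (U k).indicator 1 ω) / (n : ℝ) ∂μ = μ.real (U 0) := by
    filter_upwards [eventually_gt_atTop 0] with n hn
    have hUk (k : ℕ) : ∫ ω, (U k).indicator 1 ω ∂μ = μ.real (U 0) := by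
      rw [integral_indicator_one (hU k)]
      simp only [measureReal_def, U, hξ.measure_shift_mem (measurableSet_escapePaths δ)]
    rw [integral_div, integral_finsetSum _ fun k _ => (integrable_const _).indicator (hU k)]
    simp only [hUk, Finset.sum_const, Finset.card_range, nsmul_eq_mul]
    exact mul_div_cancel_left₀ _ (Nat.cast_ne_zero.2 hn.ne')
  rw [integral_zero] at hfreq
  have := tendsto_nhds_unique (hfreq.congr' hmean) tendsto_const_nhds
  simpa [U] using (measureReal_eq_zero_iff).1 this.symm

/-- From some time on, a walk that is bounded above stays within `η / 2` above its position, and a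
step below `-η` in front of such a path makes the negated walk escape. -/
theorem ae_not_bddAbove_sum_of_integral_eq_zero [IsFiniteMeasure μ] (hint : Integrable (ξ 0) μ)
    (hzero : ∫ ω, ξ 0 ω ∂μ = 0) (hne : ¬ ξ 0 =ᵐ[μ] 0) :
    ∀ᵐ ω ∂μ, ¬ BddAbove (range fun n => ∑ i ∈ Finset.range n, ξ i ω) := by
  obtain ⟨η, hη, hη_ne⟩ := exists_measure_lt_neg_ne_zero hint hzero hne
  let D : Set (ℕ → ℝ) := {x | ∀ m, ∑ i ∈ Finset.range m, x i ≤ η / 2}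
  have hD : MeasurableSet D := by
    simp only [D, ofPred_forall]
    exact MeasurableSet.iInter fun m => measurableSet_le (by fun_prop) measurable_const
  have hescape : {ω | ξ 0 ω ∈ Iio (-η) ∧ (fun i => ξ (1 + i) ω) ∈ D} ⊆
      {ω | (fun i => -ξ i ω) ∈ escapePaths (η / 2)} := by
    rintro ω ⟨hstep : ξ 0 ω < -η, hω⟩ m
    rw [add_comm m 1, Finset.sum_range_add, Finset.sum_range_one, Finset.sum_neg_distrib]
    linarith [hω m]
  have hD_zero : μ {ω | (fun i => ξ i ω) ∈ D} = 0 := by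
    have h := measure_mono_null hescape <| (hξ.comp measurable_neg).measure_escapePaths_eq_zero
      hint.neg (by rw [integral_neg, hzero, neg_zero]) (half_pos hη)
    rw [hξ.measure_zero_mem_and_shift_mem measurableSet_Iio hD] at h
    exact (mul_eq_zero.1 h).resolve_left hη_ne
  have hshift : ∀ᵐ ω ∂μ, ∀ k, (fun i => ξ (k + i) ω) ∉ D := ae_all_iff.2 fun k =>
    measure_eq_zero_iff_ae_notMem.1 ((hξ.measure_shift_mem hD k).trans hD_zero)
  filter_upwards [hshift] with ω hω hbdd
  obtain ⟨_, ⟨k, rfl⟩, hk⟩ := exists_lt_of_lt_csSup (range_nonempty _)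
    (sub_lt_self (sSup (range fun n => ∑ i ∈ Finset.range n, ξ i ω)) (half_pos hη))
  refine hω k fun m => ?_
  have hle := le_csSup hbdd ⟨k + m, rfl⟩
  simp only [Finset.sum_range_add] at hle
  linarith

theorem ae_not_tendsto_sum_of_integral_eq_zero [IsFiniteMeasure μ] (hint : Integrable (ξ 0) μ)
    (hzero : ∫ ω, ξ 0 ω ∂μ = 0) (hne : ¬ ξ 0 =ᵐ[μ] 0) :
    ∀ᵐ ω ∂μ, ¬ Tendsto (fun n => ∑ i ∈ Finset.range n, ξ i ω) atTop atTop := by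
  have hne' : ¬ (fun ω => -ξ 0 ω) =ᵐ[μ] 0 := fun h => hne (h.mono fun ω hω => neg_eq_zero.1 hω)
  filter_upwards [(hξ.comp measurable_neg).ae_not_bddAbove_sum_of_integral_eq_zero hint.neg
    (by rw [integral_neg, hzero, neg_zero]) hne'] with ω hω h
  refine hω ?_
  obtain ⟨b, hb⟩ := bddBelow_range_of_tendsto_atTop_atTop h
  exact ⟨-b, by rintro _ ⟨n, rfl⟩; simpa using hb ⟨n, rfl⟩⟩

end IsIID

/-! ### Extended-valued expectations -/

section Expectation

variable {Ω : Type*} [MeasurableSpace Ω] {μ : Measure Ω} {Y : Ω → ℝ}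

theorem integrable_of_lintegral_ne_top (hY : Measurable Y)
    (hpos : ∫⁻ ω, ENNReal.ofReal (Y ω) ∂μ ≠ ∞) (hneg : ∫⁻ ω, ENNReal.ofReal (-Y ω) ∂μ ≠ ∞) :
    Integrable Y μ := by
  have h := (integrable_toReal_of_lintegral_ne_top hY.ennreal_ofReal.aemeasurable hpos).sub
    (integrable_toReal_of_lintegral_ne_top hY.neg.ennreal_ofReal.aemeasurable hneg)
  refine h.congr (.of_forall fun ω => ?_)
  simp only [Pi.sub_apply, Pi.neg_apply, ENNReal.toReal_ofReal']
  exact max_zero_sub_eq_self (Y ω)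

theorem integrable_of_eExpectation_nonneg (hY : Measurable Y)
    (hpos : ∫⁻ ω, ENNReal.ofReal (Y ω) ∂μ ≠ ∞) (h : 0 ≤ eExpectation Y μ) : Integrable Y μ := by
  refine integrable_of_lintegral_ne_top hY hpos fun hneg => h.not_gt ?_
  rw [eExpectation, hneg, EReal.coe_ennreal_top, EReal.sub_top]
  exact EReal.bot_lt_zero

theorem integrable_and_integral_eq_zero (hY : Measurable Y)
    (hpos : ∫⁻ ω, ENNReal.ofReal (Y ω) ∂μ ≠ ∞) (h : eExpectation Y μ = 0) :
    Integrable Y μ ∧ ∫ ω, Y ω ∂μ = 0 := by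
  have hint := integrable_of_eExpectation_nonneg hY hpos h.ge
  exact ⟨hint, EReal.coe_eq_zero.1 ((eExpectation_eq_integral hint).symm.trans h)⟩

theorem lintegral_eq_iSup_lintegral_min_natCast {f : Ω → ℝ≥0∞} (hf : Measurable f) :
    ∫⁻ ω, f ω ∂μ = ⨆ n : ℕ, ∫⁻ ω, min (f ω) n ∂μ := by
  rw [← lintegral_iSup (f := fun (n : ℕ) ω => min (f ω) n) (fun n => hf.min measurable_const)
    (fun m n hmn ω => min_le_min_left _ (Nat.cast_le.2 hmn))]
  simp only [← inf_iSup_eq, ENNReal.iSup_natCast, inf_top_eq]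

theorem exists_integral_max_neg [IsFiniteMeasure μ] (hY : Measurable Y)
    (hpos : ∫⁻ ω, ENNReal.ofReal (Y ω) ∂μ ≠ ∞) (h : eExpectation Y μ < 0) :
    ∃ M : ℝ, Integrable (fun ω => max (Y ω) (-M)) μ ∧ ∫ ω, max (Y ω) (-M) ∂μ < 0 := by
  have hlt : ∫⁻ ω, ENNReal.ofReal (Y ω) ∂μ < ∫⁻ ω, ENNReal.ofReal (-Y ω) ∂μ := by
    refine EReal.coe_ennreal_lt_coe_ennreal_iff.1 ((EReal.sub_neg ?_ ?_).1 h) <;> simp [hpos]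
  obtain ⟨n, hn⟩ := lt_iSup_iff.1
    (hlt.trans_eq (lintegral_eq_iSup_lintegral_min_natCast hY.neg.ennreal_ofReal))
  have hmax (ω : Ω) : ENNReal.ofReal (max (Y ω) (-n)) = ENNReal.ofReal (Y ω) := by
    rw [ENNReal.ofReal_max, ENNReal.ofReal_of_nonpos (neg_nonpos.2 n.cast_nonneg)]
    exact max_eq_left zero_le
  have hmin (ω : Ω) : ENNReal.ofReal (-max (Y ω) (-n)) = min (ENNReal.ofReal (-Y ω)) n := by
    rw [← min_neg_neg, neg_neg, ENNReal.ofReal_min, ENNReal.ofReal_natCast]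
  have hfin : ∫⁻ ω, min (ENNReal.ofReal (-Y ω)) n ∂μ ≠ ∞ :=
    ((lintegral_mono fun _ => min_le_right _ _).trans_lt
      (lintegral_const_lt_top (ENNReal.natCast_ne_top n))).ne
  have hint : Integrable (fun ω => max (Y ω) (-n)) μ :=
    integrable_of_lintegral_ne_top (hY.max measurable_const) (by simpa only [hmax] using hpos)
      (by simpa only [hmin] using hfin)
  refine ⟨n, hint, EReal.coe_lt_coe_iff.1 ?_⟩
  rw [← eExpectation_eq_integral hint, eExpectation, EReal.coe_zero]
  simp only [hmax, hmin]
  refine (EReal.sub_neg ?_ ?_).2 (EReal.coe_ennreal_lt_coe_ennreal_iff.2 hn) <;> simp [hpos]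

end Expectation

namespace IsIID

variable {Ω : Type*} [MeasurableSpace Ω] {ξ : ℕ → Ω → ℝ} {μ : Measure Ω} (hξ : IsIID ξ μ)
  (hpos : ∫⁻ ω, ENNReal.ofReal (ξ 0 ω) ∂μ ≠ ∞)

include hξ hpos

theorem exists_ae_linear_le_sum (hE : 0 < eExpectation (ξ 0) μ) :
    ∃ a > 0, ∀ᵐ ω ∂μ, ∃ b, ∀ n : ℕ, a * n + b ≤ ∑ i ∈ Finset.range n, ξ i ω := by
  have hint := integrable_of_eExpectation_nonneg (hξ.measurable 0) hpos hE.le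
  rw [eExpectation_eq_integral hint] at hE
  obtain ⟨a, ha, ha'⟩ := exists_between (EReal.coe_pos.1 hE)
  exact ⟨a, ha, (hξ.ae_tendsto_sum_div hint).mono fun ω hω => exists_linear_le hω ha'⟩

theorem ae_bddAbove_sum [IsFiniteMeasure μ] (hE : eExpectation (ξ 0) μ < 0) :
    ∀ᵐ ω ∂μ, BddAbove (range fun n => ∑ i ∈ Finset.range n, ξ i ω) := by
  obtain ⟨M, hint, hneg⟩ := exists_integral_max_neg (hξ.measurable 0) hpos hE
  filter_upwards [(hξ.comp (measurable_id.max measurable_const)).ae_tendsto_sum_div hint] with ω hω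
  obtain ⟨b, hb⟩ := exists_le_linear hω hneg
  refine ⟨b, forall_mem_range.2 fun n =>
    (Finset.sum_le_sum fun i _ => le_max_left _ _).trans (by simpa using hb n)⟩

theorem ae_not_bddAbove_sum [IsFiniteMeasure μ] (hE : 0 ≤ eExpectation (ξ 0) μ)
    (hne : ¬ ξ 0 =ᵐ[μ] 0) :
    ∀ᵐ ω ∂μ, ¬ BddAbove (range fun n => ∑ i ∈ Finset.range n, ξ i ω) := by
  rcases hE.eq_or_lt with hE | hE
  · obtain ⟨hint, hzero⟩ := integrable_and_integral_eq_zero (hξ.measurable 0) hpos hE.symm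
    exact hξ.ae_not_bddAbove_sum_of_integral_eq_zero hint hzero hne
  · obtain ⟨a, ha, h⟩ := hξ.exists_ae_linear_le_sum hpos hE
    filter_upwards [h] with ω ⟨b, hb⟩
    exact not_bddAbove_of_tendsto_atTop <| tendsto_atTop_mono hb <|
      tendsto_atTop_add_const_right _ b (tendsto_natCast_atTop_atTop.const_mul_atTop ha)

theorem ae_not_tendsto_sum [IsFiniteMeasure μ] (hE : eExpectation (ξ 0) μ ≤ 0)
    (hne : ¬ ξ 0 =ᵐ[μ] 0) :
    ∀ᵐ ω ∂μ, ¬ Tendsto (fun n => ∑ i ∈ Finset.range n, ξ i ω) atTop atTop := by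
  rcases hE.eq_or_lt with hE | hE
  · obtain ⟨hint, hzero⟩ := integrable_and_integral_eq_zero (hξ.measurable 0) hpos hE
    exact hξ.ae_not_tendsto_sum_of_integral_eq_zero hint hzero hne
  · exact (hξ.ae_bddAbove_sum hpos hE).mono fun ω hω h => not_bddAbove_of_tendsto_atTop h hω

end IsIID

/-! ### Products of random weights -/

section WeightProd

variable {w : ℕ → ℝ} (hw : ∀ n, 0 < w n)

include hw

theorem weightProd_eq_exp_sum_log (n : ℕ) :
    weightProd w n = Real.exp (∑ i ∈ Finset.range n, Real.log (w i)) := by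
  rw [Real.exp_sum]
  exact Finset.prod_congr rfl fun i _ => (Real.exp_log (hw i)).symm

theorem bddAbove_range_weightProd_iff :
    BddAbove (range (weightProd w)) ↔
      BddAbove (range fun n => ∑ i ∈ Finset.range n, Real.log (w i)) := by
  simp only [bddAbove_def, forall_mem_range, weightProd_eq_exp_sum_log hw]
  refine ⟨fun ⟨K, hK⟩ => ⟨Real.log K, fun n => ?_⟩, fun ⟨K, hK⟩ => ⟨Real.exp K, fun n => ?_⟩⟩
  · exact (Real.le_log_iff_exp_le ((Real.exp_pos _).trans_le (hK n))).2 (hK n)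
  · exact Real.exp_le_exp.2 (hK n)

theorem tendsto_weightProd_iff :
    Tendsto (weightProd w) atTop atTop ↔
      Tendsto (fun n => ∑ i ∈ Finset.range n, Real.log (w i)) atTop atTop := by
  rw [funext (weightProd_eq_exp_sum_log hw), Real.tendsto_exp_comp_atTop]

end WeightProd

variable {Ω : Type*} [MeasurableSpace Ω] {μ : Measure Ω}

section EssRange

variable {Y : Ω → ℝ}

theorem ae_mem_essRange (hY : Measurable Y) : ∀ᵐ ω ∂μ, Y ω ∈ essRange Y μ := by
  refine ae_of_ae_map hY.aemeasurable (measure_null_of_locally_null _ fun t ht => ?_)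
  obtain ⟨ε, hε, hnull⟩ : ∃ ε > 0, μ {ω | |Y ω - t| < ε} = 0 := by
    by_contra! hcon
    exact ht fun ε hε => pos_iff_ne_zero.2 (hcon ε hε)
  refine ⟨Metric.ball t ε, mem_nhdsWithin_of_mem_nhds (Metric.ball_mem_nhds t hε), ?_⟩
  rw [Measure.map_apply hY Metric.isOpen_ball.measurableSet]
  exact hnull

theorem measure_le_ne_zero_of_mem_essRange {r t : ℝ} (ht : t ∈ essRange Y μ) (hr : r < t) :
    μ {ω | r ≤ Y ω} ≠ 0 := by
  refine ((ht (t - r) (sub_pos.2 hr)).trans_le (measure_mono fun ω hω => ?_)).ne'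
  have hlt := (abs_lt.1 (show |Y ω - t| < t - r from hω)).1
  exact (by linarith : r ≤ Y ω)

theorem not_ae_eq_const_of_nontrivial_essRange (h : (essRange Y μ).Nontrivial) (c : ℝ) :
    ¬ ∀ᵐ ω ∂μ, Y ω = c := by
  intro hc
  obtain ⟨t, ht, hne⟩ := h.exists_ne c
  refine (ht |c - t| (abs_pos.2 (sub_ne_zero.2 hne.symm))).ne'
    (measure_eq_zero_iff_ae_notMem.2 (hc.mono fun ω hω => ?_))
  simp [hω]

theorem log_not_ae_eq_zero (hpos : ∀ᵐ ω ∂μ, 0 < Y ω) (h : (essRange Y μ).Nontrivial) :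
    ¬ (fun ω => Real.log (Y ω)) =ᵐ[μ] 0 := fun hlog =>
  not_ae_eq_const_of_nontrivial_essRange h 1 <| by
    filter_upwards [hlog, hpos] with ω hω hω0 using Real.eq_one_of_pos_of_log_eq_zero hω0 hω

theorem lintegral_ofReal_log_ne_top [IsFiniteMeasure μ] (hnonneg : ∀ᵐ ω ∂μ, 0 ≤ Y ω)
    (hbdd : ∃ C : ℝ, ∀ᵐ ω ∂μ, Y ω ≤ C) :
    ∫⁻ ω, ENNReal.ofReal (Real.log (Y ω)) ∂μ ≠ ∞ := by
  obtain ⟨C, hC⟩ := hbdd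
  refine ((lintegral_mono_ae ?_).trans_lt (lintegral_const_lt_top (c := ENNReal.ofReal C)
    ENNReal.ofReal_ne_top)).ne
  filter_upwards [hnonneg, hC] with ω h0 hC
  exact ENNReal.ofReal_le_ofReal ((Real.log_le_self h0).trans hC)

end EssRange

namespace IsIID

variable {X : ℕ → Ω → ℝ} (hX : IsIID X μ) (hpos : ∀ᵐ ω ∂μ, 0 < X 0 ω)

include hX

theorem ae_exists_run_of_lt_essMax [IsFiniteMeasure μ] (hne : (essRange (X 0) μ).Nonempty)
    (hbdd : ∃ C : ℝ, ∀ᵐ ω ∂μ, X 0 ω ≤ C) {r : ℝ} (hr : r < essMax (X 0) μ) :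
    ∀ᵐ ω ∂μ, ∀ L, ∃ k, ∀ i < L, r ≤ X (k + i) ω :=
  ae_all_iff.2 (hX.ae_exists_run measurableSet_Ici
    (measure_le_ne_zero_of_mem_essRange (isGreatest_essMax hne hbdd).1 hr))

theorem ae_forall_le_essMax (hne : (essRange (X 0) μ).Nonempty)
    (hbdd : ∃ C : ℝ, ∀ᵐ ω ∂μ, X 0 ω ≤ C) : ∀ᵐ ω ∂μ, ∀ n, X n ω ≤ essMax (X 0) μ :=
  hX.ae_forall_mem measurableSet_Iic <|
    (ae_mem_essRange (hX.measurable 0)).mono fun _ h => (isGreatest_essMax hne hbdd).2 h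

include hpos

theorem ae_isBackwardShift_adjoint_randomShift {H : Type*} [NormedAddCommGroup H]
    [InnerProductSpace ℂ H] [CompleteSpace H] (e : HilbertBasis ℕ ℂ H)
    (hbdd : ∃ C : ℝ, ∀ᵐ ω ∂μ, X 0 ω ≤ C) :
    ∀ᵐ ω ∂μ, IsBackwardShift e (fun n => X n ω)
      (ContinuousLinearMap.adjoint (randomShift e X ω)) := by
  obtain ⟨C, hC⟩ := hbdd
  filter_upwards [hX.ae_forall_mem measurableSet_Ioi hpos, hX.ae_forall_mem measurableSet_Iic hC]
    with ω h0 hC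
  exact isBackwardShift_adjoint e h0 ⟨C, fun n => (abs_of_pos (h0 n)).trans_le (hC n)⟩

variable (hlog : ∫⁻ ω, ENNReal.ofReal (Real.log (X 0 ω)) ∂μ ≠ ∞)

include hlog

theorem ae_exists_mul_pow_le_weightProd
    (hE : 0 < eExpectation (fun ω => Real.log (X 0 ω)) μ) :
    ∀ᵐ ω ∂μ, ∃ c > 0, ∃ ρ > 1, ∀ n, c * ρ ^ n ≤ weightProd (fun n => X n ω) n := by
  obtain ⟨a, ha, h⟩ := (hX.comp Real.measurable_log).exists_ae_linear_le_sum hlog hE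
  filter_upwards [hX.ae_forall_mem measurableSet_Ioi hpos, h] with ω h0 ⟨b, hb⟩
  refine ⟨Real.exp b, Real.exp_pos b, Real.exp a, Real.one_lt_exp_iff.2 ha, fun n => ?_⟩
  rw [weightProd_eq_exp_sum_log h0, ← Real.exp_nat_mul, ← Real.exp_add, Real.exp_le_exp]
  linarith [hb n]

theorem ae_tendsto_weightProd (hE : 0 < eExpectation (fun ω => Real.log (X 0 ω)) μ) :
    ∀ᵐ ω ∂μ, Tendsto (weightProd fun n => X n ω) atTop atTop := by
  filter_upwards [hX.ae_exists_mul_pow_le_weightProd hpos hlog hE] with ω ⟨c, hc, ρ, hρ, h⟩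
  exact tendsto_atTop_mono h ((tendsto_pow_atTop_atTop_of_one_lt hρ).const_mul_atTop hc)

variable [IsFiniteMeasure μ]

theorem ae_bddAbove_weightProd (hE : eExpectation (fun ω => Real.log (X 0 ω)) μ < 0) :
    ∀ᵐ ω ∂μ, BddAbove (range (weightProd fun n => X n ω)) := by
  filter_upwards [hX.ae_forall_mem measurableSet_Ioi hpos,
    (hX.comp Real.measurable_log).ae_bddAbove_sum hlog hE] with ω h0 h
  exact (bddAbove_range_weightProd_iff h0).2 h

theorem ae_not_bddAbove_weightProd (hne : ¬ (fun ω => Real.log (X 0 ω)) =ᵐ[μ] 0)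
    (hE : 0 ≤ eExpectation (fun ω => Real.log (X 0 ω)) μ) :
    ∀ᵐ ω ∂μ, ¬ BddAbove (range (weightProd fun n => X n ω)) := by
  filter_upwards [hX.ae_forall_mem measurableSet_Ioi hpos,
    (hX.comp Real.measurable_log).ae_not_bddAbove_sum hlog hE hne] with ω h0 h
  exact (bddAbove_range_weightProd_iff h0).not.2 h

theorem ae_not_tendsto_weightProd (hne : ¬ (fun ω => Real.log (X 0 ω)) =ᵐ[μ] 0)
    (hE : eExpectation (fun ω => Real.log (X 0 ω)) μ ≤ 0) :
    ∀ᵐ ω ∂μ, ¬ Tendsto (weightProd fun n => X n ω) atTop atTop := by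
  filter_upwards [hX.ae_forall_mem measurableSet_Ioi hpos,
    (hX.comp Real.measurable_log).ae_not_tendsto_sum hlog hE hne] with ω h0 h
  exact (tendsto_weightProd_iff h0).not.2 h

end IsIID

end RandomShift

/-- The weights are indexed from `0`, so `X 0` is the first one. Probability one is `∀ᵐ ω, P ω`
and probability zero is `∀ᵐ ω, ¬ P ω`; each implies that the event is null measurable. -/
theorem theorem9p1 {Ω : Type*} [MeasurableSpace Ω] (μ : Measure Ω) [IsProbabilityMeasure μ]
    {H : Type*} [NormedAddCommGroup H] [InnerProductSpace ℂ H] [CompleteSpace H]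
    (e : HilbertBasis ℕ ℂ H) (X : ℕ → Ω → ℝ)
    (hmeas : ∀ n, Measurable (X n))
    (hindep : iIndepFun X μ)
    (hident : ∀ n, IdentDistrib (X n) (X 0) μ μ)
    (hnonneg : ∀ᵐ ω ∂μ, 0 ≤ X 0 ω)
    (hbdd : ∃ C : ℝ, ∀ᵐ ω ∂μ, X 0 ω ≤ C)
    (hnondeg : (essRange (X 0) μ).Nontrivial)
    (hzero : μ {ω | X 0 ω = 0} = 0) :
    -- supercyclicity
    (∀ᵐ ω ∂μ, IsSupercyclic (ContinuousLinearMap.adjoint (randomShift e X ω))) ∧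
    -- hypercyclicity
    ((0 ≤ eExpectation (fun ω => Real.log (X 0 ω)) μ →
        ∀ᵐ ω ∂μ, IsHypercyclic (ContinuousLinearMap.adjoint (randomShift e X ω))) ∧
      (eExpectation (fun ω => Real.log (X 0 ω)) μ < 0 →
        ∀ᵐ ω ∂μ, ¬ IsHypercyclic (ContinuousLinearMap.adjoint (randomShift e X ω)))) ∧
    -- Li–Yorke chaos
    ((1 < essMax (X 0) μ →
        ∀ᵐ ω ∂μ, IsLiYorkeChaotic (ContinuousLinearMap.adjoint (randomShift e X ω))) ∧
      (essMax (X 0) μ ≤ 1 →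
        ∀ᵐ ω ∂μ, ¬ IsLiYorkeChaotic (ContinuousLinearMap.adjoint (randomShift e X ω)))) ∧
    -- topological mixing
    ((0 < eExpectation (fun ω => Real.log (X 0 ω)) μ →
        ∀ᵐ ω ∂μ, IsTopologicallyMixing (ContinuousLinearMap.adjoint (randomShift e X ω))) ∧
      (eExpectation (fun ω => Real.log (X 0 ω)) μ ≤ 0 →
        ∀ᵐ ω ∂μ, ¬ IsTopologicallyMixing (ContinuousLinearMap.adjoint (randomShift e X ω)))) ∧
    -- chaos and frequent hypercyclicity
    ((0 < eExpectation (fun ω => Real.log (X 0 ω)) μ →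
        (∀ᵐ ω ∂μ, IsChaotic (ContinuousLinearMap.adjoint (randomShift e X ω))) ∧
        (∀ᵐ ω ∂μ, IsFrequentlyHypercyclic (ContinuousLinearMap.adjoint (randomShift e X ω)))) ∧
      (eExpectation (fun ω => Real.log (X 0 ω)) μ ≤ 0 →
        (∀ᵐ ω ∂μ, ¬ IsChaotic (ContinuousLinearMap.adjoint (randomShift e X ω))) ∧
        (∀ᵐ ω ∂μ,
          ¬ IsFrequentlyHypercyclic (ContinuousLinearMap.adjoint (randomShift e X ω))))) := by
  have hX : IsIID X μ := ⟨hmeas, hindep, hident⟩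
  have hpos : ∀ᵐ ω ∂μ, 0 < X 0 ω := by
    filter_upwards [hnonneg, measure_eq_zero_iff_ae_notMem.1 hzero] with ω h0 hne
    exact h0.lt_of_ne' hne
  have hlog := lintegral_ofReal_log_ne_top hnonneg hbdd
  have hne := log_not_ae_eq_zero hpos hnondeg
  have hB := hX.ae_isBackwardShift_adjoint_randomShift hpos e hbdd
  have hgrowth := hX.ae_exists_mul_pow_le_weightProd hpos hlog
  have hunbdd := hX.ae_not_bddAbove_weightProd hpos hlog hne
  have hntend := hX.ae_not_tendsto_weightProd hpos hlog hne
  refine ⟨hB.mono fun ω hB => hB.isSupercyclic, ⟨fun hE => ?_, fun hE => ?_⟩, ⟨fun hR => ?_,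
    fun hR => ?_⟩, ⟨fun hE => ?_, fun hE => ?_⟩, ⟨fun hE => ⟨?_, ?_⟩, fun hE => ⟨?_, ?_⟩⟩⟩
  · filter_upwards [hB, hunbdd hE] with ω hB using hB.isHypercyclic
  · filter_upwards [hB, hX.ae_bddAbove_weightProd hpos hlog hE] with ω hB using hB.not_isHypercyclic
  · obtain ⟨r, hr, hrR⟩ := exists_between hR
    filter_upwards [hB, hX.ae_exists_run_of_lt_essMax hnondeg.nonempty hbdd hrR] with ω hB using
      hB.isLiYorkeChaotic hr
  · filter_upwards [hB, hX.ae_forall_le_essMax hnondeg.nonempty hbdd] with ω hB hle using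
      hB.not_isLiYorkeChaotic fun n => (hle n).trans hR
  · filter_upwards [hB, hX.ae_tendsto_weightProd hpos hlog hE] with ω hB using
      hB.isTopologicallyMixing
  · filter_upwards [hB, hntend hE] with ω hB using hB.not_isTopologicallyMixing
  · filter_upwards [hB, hgrowth hE] with ω hB ⟨c, hc, ρ, hρ, h⟩ using hB.isChaotic hc hρ h
  · filter_upwards [hB, hgrowth hE] with ω hB ⟨c, hc, ρ, hρ, h⟩ using
      hB.isFrequentlyHypercyclic hc hρ h
  · filter_upwards [hB, hntend hE] with ω hB using hB.not_isChaotic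
  · filter_upwards [hB, hntend hE] with ω hB using hB.not_isFrequentlyHypercyclic
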